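/- Let $p$ be a prime number, let $F$ be a finite extension of $\mathbb{Q}_p$ and let $q$ be the cardinality of its residue field. Let $\|\cdot\|$ be the $p$-adic norm on the finite extensions of $F$, normalized by $\|p\| = p^{-[F:\mathbb{Q}_p]}$. For a finite extension $L$ of $\mathbb{Q}_p$, let $\mathcal{O}_L$ be its ring of integers and $\lambda_L$ the Haar measure on $L$ with $\lambda_L(\mathcal{O}_L)=1$. For $m \ge 0$ let $\Omega_m \simeq \mathcal{O}_F^{m+1}$ be the space of polynomials of degree at most $m$ with coefficients in $\mathcal{O}_F$, with the probability measure $\lambda_F^{\otimes (m+1)}$. For a finite extension $K$ of $F$ of degree $r$, with discriminant $D_K$ over $F$, and an integer $n \geq 1$, define the density function $\rho_{K,n} : K \to \mathbb{R}_{\ge 0}$ as follows. For $x \in \mathcal{O}_K$, put $$\rho_{K,n}(x) = \frac{\|D_K\|}{\#(\mathcal{O}_K/\mathcal{O}_F[x])} \int_{\Omega_{n-r}} \|Q(x)\|^r \, dQ$$ if $n \geq r$ and $F[x] = K$, and $\rho_{K,n}(x) = 0$ otherwise. For $x \in K \setminus \mathcal{O}_K$, put $\rho_{K,n}(x) = \|x\|^{-2r}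 \rho_{K,n}(x^{-1})$. Let $\rho_n(K) = \int_K \rho_{K,n}(x) \, d\lambda_K(x)$. Theorem C. Let $K$ be a quadratic extension of $F$. Then $\rho_{K,n}$ is integrable on $K$ for all $n \ge 1$, and: (i) If $K/F$ is unramified, then $$\rho_2(K) = \frac{q^2-q+1}{q^2+q+1}, \qquad \rho_n(K) = \frac{q^4+1}{q^4+q^3+q^2+q+1} \quad \text{for all } n \geq 3.$$ (ii) If $K/F$ is totally ramified, then $$\rho_2(K) = \|D_K\| \cdot \frac{q^2}{q^2+q+1}, \qquad \rho_n(K) = \|D_K\| \cdot \frac{q^2(q^2+1)}{q^4+q^3+q^2+q+1} \quad \text{for all } n \geq 3.$$ -/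

import Mathlib

open MeasureTheory Module

noncomputable section

namespace PadicRoots

section OneField

variable (p : ℕ) [Fact p.Prime] (L : Type*) [NormedField L] [NormedAlgebra ℚ_[p] L]

/-- The ring of integers of a finite extension `L` of `ℚ_[p]`: the elements of norm at most `1`. -/
def integerRing : ValuationSubring L :=
  haveI : IsUltrametricDist L := IsUltrametricDist.of_normedAlgebra ℚ_[p]
  (NormedField.valuation (K := L)).valuationSubring

theorem mem_integerRing {x : L} : x ∈ integerRing p L ↔ ‖x‖ ≤ 1 := Iff.rfl

theorem charZero_of_padic (p : ℕ) [Fact p.Prime] (L : Type*) [NormedField L]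
    [NormedAlgebra ℚ_[p] L] : CharZero L :=
  charZero_of_injective_algebraMap (algebraMap ℚ_[p] L).injective

theorem properSpace_of_padic [FiniteDimensional ℚ_[p] L] : ProperSpace L :=
  FiniteDimensional.proper ℚ_[p] L

instance [FiniteDimensional ℚ_[p] L] : IsPrincipalIdealRing (integerRing p L) := by
  let : IsUltrametricDist L := IsUltrametricDist.of_normedAlgebra ℚ_[p]
  let : Valued L NNReal := NormedField.toValued
  have hp : ProperSpace L := properSpace_of_padic p L
  have hc : IsCompact {x : L | ‖x‖ ≤ 1} := by
    simpa [Metric.closedBall] using isCompact_closedBall (0 : L) 1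
  have : CompactSpace (Valued.integer L) := isCompact_iff_compactSpace.mp hc
  have := Valued.integer.isPrincipalIdealRing_of_compactSpace (K := L)
  exact inferInstanceAs (IsPrincipalIdealRing (Valued.integer L))

/-- The Haar measure `λ_L` on `L`, normalized by giving mass `1` to the ring of integers of `L`. -/
def haar [FiniteDimensional ℚ_[p] L] [MeasurableSpace L] [BorelSpace L] : Measure L :=
  Measure.addHaarMeasure
    { carrier := (integerRing p L : Set L)
      isCompact' := by
        have := properSpace_of_padic p L
        have h : (integerRing p L : Set L) = Metric.closedBall 0 1 := by
          ext x; simp [mem_integerRing]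
        exact h ▸ isCompact_closedBall 0 1
      interior_nonempty' := by
        have h : (integerRing p L : Set L) = Metric.closedBall 0 1 := by
          ext x; simp [mem_integerRing]
        exact h ▸ ⟨0, Metric.ball_subset_interior_closedBall (by simp)⟩ }

/-- The cardinality `q` of the residue field of `L`. -/
def residueCard : ℕ := Nat.card (IsLocalRing.ResidueField (integerRing p L))

end OneField

/-- The `p`-adic norm on the extensions `L` of `F`, normalized by `‖p‖ = p ^ (-[F : ℚ_p])`. -/
def pnorm (p : ℕ) [Fact p.Prime] (F : Type*) [NormedField F] [NormedAlgebra ℚ_[p] F]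
    {L : Type*} [NormedField L] (x : L) : ℝ :=
  ‖x‖ ^ finrank ℚ_[p] F

section Extension

variable (p : ℕ) [Fact p.Prime]
  (F : Type*) [NormedField F] [NormedAlgebra ℚ_[p] F] [FiniteDimensional ℚ_[p] F]
  (K : Type*) [NormedField K] [NormedAlgebra ℚ_[p] K] [FiniteDimensional ℚ_[p] K]
  [Algebra F K] [IsScalarTower ℚ_[p] F K]

/-- The ring of integers `𝒪_K` of `K`, as an algebra over `𝒪_F`. -/
def integers : Subalgebra (integerRing p F) K := integralClosure (integerRing p F) K

theorem norm_algebraMap_of_padic (p : ℕ) [Fact p.Prime]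
    (F : Type*) [NormedField F] [NormedAlgebra ℚ_[p] F] [FiniteDimensional ℚ_[p] F]
    (K : Type*) [NormedField K] [NormedAlgebra ℚ_[p] K] [FiniteDimensional ℚ_[p] K]
    [Algebra F K] [IsScalarTower ℚ_[p] F K] (a : F) : ‖algebraMap F K a‖ = ‖a‖ := by
  rw [NormedAlgebra.norm_eq_spectralNorm ℚ_[p] (algebraMap F K a),
    NormedAlgebra.norm_eq_spectralNorm ℚ_[p] a, ← spectralNorm.eq_of_tower]

theorem mem_integers {x : K} : x ∈ integers p F K ↔ ‖x‖ ≤ 1 := by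
  have h1 (a : F) (ha : ‖a‖ ≤ 1) : ‖algebraMap F K a‖ ≤ 1 := by
    rwa [norm_algebraMap_of_padic p F K a]
  constructor
  · intro hx
    let φ : integerRing p F →+* integerRing p K :=
      ((algebraMap F K).comp (integerRing p F).subtype).codRestrict (integerRing p K)
        fun a => h1 a a.2
    have h2 : IsIntegral (integerRing p K) x :=
      IsIntegral.map_of_comp_eq φ (RingHom.id K) (by ext; rfl) hx
    obtain ⟨y, rfl⟩ := IsIntegrallyClosed.isIntegral_iff.mp h2
    exact y.2
  · intro hx
    rw [NormedAlgebra.norm_eq_spectralNorm ℚ_[p] x, spectralNorm, spectralValue_le_one_iff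
      (minpoly.monic (Algebra.IsIntegral.isIntegral x))] at hx
    have hm := minpoly.monic (Algebra.IsIntegral.isIntegral (R := ℚ_[p]) x)
    have h3 : (minpoly ℚ_[p] x).map (algebraMap ℚ_[p] F) ∈
        Polynomial.lifts (algebraMap (integerRing p F) F) := by
      rw [Polynomial.lifts_iff_coeff_lifts]
      refine fun n => ⟨⟨algebraMap ℚ_[p] F ((minpoly ℚ_[p] x).coeff n), ?_⟩, ?_⟩
      · exact (norm_algebraMap' F _).le.trans (hx n)
      · rw [Polynomial.coeff_map]; rfl
    obtain ⟨P, hP, -, hPm⟩ := Polynomial.lifts_and_natDegree_eq_and_monic h3 (hm.map _)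
    refine ⟨P, hPm, ?_⟩
    rw [IsScalarTower.algebraMap_eq (integerRing p F) F K, ← Polynomial.eval₂_map, hP,
      Polynomial.eval₂_map, ← IsScalarTower.algebraMap_eq]
    exact minpoly.aeval ℚ_[p] x

instance : Module.Finite (integerRing p F) (integers p F K) :=
  haveI := charZero_of_padic p F
  haveI := FiniteDimensional.right ℚ_[p] F K
  IsIntegralClosure.finite (integerRing p F) F K (integralClosure (integerRing p F) K)

instance : Module.Free (integerRing p F) (integers p F K) :=
  haveI := charZero_of_padic p F
  haveI := FiniteDimensional.right ℚ_[p] F K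
  IsIntegralClosure.module_free (integerRing p F) F K (integralClosure (integerRing p F) K)

/-- A discriminant `D_K` of `K/F`: the determinant of the trace form of `𝒪_K` over `𝒪_F` in a
basis. It depends on the basis through the square of a unit of `𝒪_F`, so its norm is well defined. -/
def discriminant : integerRing p F :=
  Algebra.discr (integerRing p F)
    (Module.Free.chooseBasis (integerRing p F) (integers p F K))

/-- The index `#(𝒪_K / 𝒪_F[x])` for `x` in `𝒪_K` (and `0` if the index is infinite). -/
def index (x : K) : ℕ :=
  (Subalgebra.toSubmodule (Algebra.adjoin (integerRing p F) {x})).toAddSubgroup.relIndex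
    (Subalgebra.toSubmodule (integers p F K)).toAddSubgroup

/-- `∫_{Ω_m} ‖Q(x)‖ ^ r dQ`, where `Ω_m`, the space of the polynomials of degree at most `m` with
coefficients in `𝒪_F`, carries the product of the Haar probability measures on the coefficients. -/
def polyIntegral [MeasurableSpace F] [BorelSpace F] (m r : ℕ) (x : K) : ℝ :=
  ∫ c : Fin (m + 1) → F, pnorm p F (∑ i, algebraMap F K (c i) * x ^ (i : ℕ)) ^ r
    ∂(Measure.pi fun _ => (haar p F).restrict (integerRing p F : Set F))

open scoped Classical in
/-- The density function `ρ_{K,n}` on `𝒪_K`. -/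
def densityOnIntegers [MeasurableSpace F] [BorelSpace F] (n : ℕ) (x : K) : ℝ :=
  if finrank F K ≤ n ∧ Algebra.adjoin F {x} = ⊤ then
    pnorm p F (discriminant p F K : F) / index p F K x *
      polyIntegral p F K (n - finrank F K) (finrank F K) x
  else 0

open scoped Classical in
/-- The density function `ρ_{K,n} : K → ℝ`. -/
def density [MeasurableSpace F] [BorelSpace F] (n : ℕ) (x : K) : ℝ :=
  if x ∈ integers p F K then densityOnIntegers p F K n x
  else (pnorm p F x ^ (2 * finrank F K))⁻¹ * densityOnIntegers p F K n x⁻¹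

/-- `ρ_n(K)`, the integral over `K` of the density function `ρ_{K,n}`. -/
def rho [MeasurableSpace F] [BorelSpace F] [MeasurableSpace K] [BorelSpace K] (n : ℕ) : ℝ :=
  ∫ x : K, density p F K n x ∂(haar p K)

/-- `K/F` is unramified: the ramification index is `1` (the residue fields are finite, so that
their extension is separable). The local ring `𝒪_K` has exactly one maximal ideal. -/
def IsUnramified : Prop :=
  ∀ P : Ideal (integers p F K), P.IsMaximal → P.ramificationIdx (integerRing p F) = 1

/-- `K/F` is totally ramified: the ramification index is `[K : F]`. -/
def IsTotallyRamified : Prop :=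
  ∀ P : Ideal (integers p F K), P.IsMaximal →
    P.ramificationIdx (integerRing p F) = finrank F K

end Extension

end PadicRoots

end

noncomputable section

namespace PadicRoots

open scoped ENNReal NNReal Pointwise
open Set

/-! Everything rests on the fact that the normalized norm of `F` is the modulus of its Haar measure
(`haar_smul`), so that indices of lattices, norms and measures determine one another. Put r = 1/q.

Inversion multiplies the Haar measure of `K` by the density ‖x‖^(-2[K:F]), exactly the factor in the
definition of the density outside 𝒪_K. Hence ρ_n(K) is the integral of the density over 𝒪_K plus its
integral over the maximal ideal (`integrable_density_and_rho_eq`).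

A quadratic `K` has an integral basis 1, θ over 𝒪_F that is orthogonal for the norm. Either the
residue field grows, and θ is any integer whose residue is new (κ = 1); or it does not, and θ is a
uniformizer with ‖θ‖² = ‖ϖ‖ (κ = r). For x = u + vθ the order 𝒪_F[x] is 𝒪_F ⊕ v𝒪_F θ, of index ‖v‖⁻¹
(`index_mul_pnorm`). A random polynomial with at least two coefficients takes a uniformly
distributed value a + bx in 𝒪_F[x] (`polyIntegral_quadratic`); a shear replaces a + bu by a, so the
mean of ‖Q(x)‖² is that of max(‖a‖², κ‖v‖²‖b‖²), which is `maxIntegral`. For n = 2 the polynomial is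
a constant. In all cases the density on 𝒪_K depends on v only, and Fubini leaves integrals over 𝒪_F.

Those integrals are found by self-similarity: 𝒪_F is its unit group, of mass 1 - r, together with
ϖ𝒪_F, a copy of 𝒪_F scaled by r (`integral_integerRing_eq`). Each integral therefore satisfies a
linear equation, or a small linear system.

It remains to match the dichotomy on residue fields with ramification. If θ has a new residue, `K`
has the same norm values as `F`, which excludes total ramification, and the discriminant is a unit;
if ‖θ‖² = ‖ϖ‖, then ϖ lies in the square of the maximal ideal, which excludes the unramified case.
-/

theorem relIndex_mul_measure {G : Type*} [AddCommGroup G] [MeasurableSpace G] [MeasurableAdd G]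
    (μ : Measure G) [μ.IsAddLeftInvariant] {H M : AddSubgroup G} (hHM : H ≤ M)
    (hH : MeasurableSet (H : Set G)) (h0 : μ H ≠ 0) (hM : μ M ≠ ∞) :
    (H.relIndex M : ℝ≥0∞) * μ H = μ M := by
  -- The cosets of `H` partition `M` and share the same mass; as `M` has finite mass and `H`
  -- positive mass, there are finitely many of them.
  let A : (M ⧸ H.addSubgroupOf M) → Set G := fun c => ((Quotient.out c : M) : G) +ᵥ (H : Set G)
  have hA (c) : MeasurableSet (A c) := hH.const_vadd _
  have hU : ⋃ c, A c = M := by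
    ext x
    simp only [A, mem_iUnion, mem_vadd_set_iff_neg_vadd_mem, vadd_eq_add, SetLike.mem_coe]
    constructor
    · rintro ⟨c, hc⟩
      simpa using M.add_mem (Quotient.out c : M).2 (hHM hc)
    · intro hx
      refine ⟨QuotientAddGroup.mk ⟨x, hx⟩, ?_⟩
      have := QuotientAddGroup.eq.mp
        (QuotientAddGroup.out_eq' (QuotientAddGroup.mk (s := H.addSubgroupOf M) ⟨x, hx⟩))
      simpa [AddSubgroup.mem_addSubgroupOf] using this
  have hd : Pairwise (Function.onFun Disjoint A) := by
    intro c d hcd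
    refine Set.disjoint_left.mpr fun x hx hx' => hcd ?_
    simp only [A, mem_vadd_set_iff_neg_vadd_mem, vadd_eq_add, SetLike.mem_coe] at hx hx'
    rw [← QuotientAddGroup.out_eq' c, ← QuotientAddGroup.out_eq' d, QuotientAddGroup.eq,
      AddSubgroup.mem_addSubgroupOf]
    simpa using H.sub_mem hx hx'
  have hμ (c) : μ (A c) = μ H := measure_vadd _ _ _
  have hfin : Finite (M ⧸ H.addSubgroupOf M) := by
    have := Measure.finite_const_le_meas_of_disjoint_iUnion μ (pos_iff_ne_zero.mpr h0) hA hd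
      (by rwa [hU])
    simp only [hμ, le_refl, Set.ofPred_true] at this
    exact Set.finite_univ_iff.mp this
  have := Fintype.ofFinite (M ⧸ H.addSubgroupOf M)
  rw [← hU, measure_iUnion hd hA, tsum_fintype]
  simp only [hμ, Finset.sum_const, nsmul_eq_mul]
  rw [AddSubgroup.relIndex, AddSubgroup.index, Nat.card_eq_fintype_card, Finset.card_univ]

/-! ### Haar measure, the maximal ideal and the residue field -/

section OneField

variable (p : ℕ) [Fact p.Prime] (L : Type*) [NormedField L] [NormedAlgebra ℚ_[p] L]

theorem isUltrametricDist_of_padic (p : ℕ) [Fact p.Prime] (L : Type*) [NormedField L]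
    [NormedAlgebra ℚ_[p] L] : IsUltrametricDist L :=
  IsUltrametricDist.of_normedAlgebra ℚ_[p]

theorem norm_add_le_max_of_padic (p : ℕ) [Fact p.Prime] (L : Type*) [NormedField L]
    [NormedAlgebra ℚ_[p] L]
    (x y : L) : ‖x + y‖ ≤ max ‖x‖ ‖y‖ :=
  have := isUltrametricDist_of_padic p L
  IsUltrametricDist.norm_add_le_max x y

theorem norm_add_eq_of_lt (p : ℕ) [Fact p.Prime] {L : Type*} [NormedField L]
    [NormedAlgebra ℚ_[p] L] {x y : L} (h : ‖y‖ < ‖x‖) : ‖x + y‖ = ‖x‖ := by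
  have := isUltrametricDist_of_padic p L
  rw [IsUltrametricDist.norm_add_eq_max_of_norm_ne_norm h.ne', max_eq_left h.le]

theorem coe_integerRing : (integerRing p L : Set L) = Metric.closedBall 0 1 := by
  ext x; simp [mem_integerRing]

theorem measurableSet_integerRing [MeasurableSpace L] [BorelSpace L] :
    MeasurableSet (integerRing p L : Set L) := by
  rw [coe_integerRing]; exact Metric.isClosed_closedBall.measurableSet

/-- The additive group of the elements of norm less than `1`. -/
def openUnitBall : AddSubgroup L where
  carrier := {x | ‖x‖ < 1}
  zero_mem' := by simp
  add_mem' {a b} ha hb := (norm_add_le_max_of_padic p L a b).trans_lt (max_lt ha hb)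
  neg_mem' {a} ha := by simpa using ha

theorem mem_openUnitBall {x : L} : x ∈ openUnitBall p L ↔ ‖x‖ < 1 := Iff.rfl

theorem measurableSet_openUnitBall [MeasurableSpace L] [BorelSpace L] :
    MeasurableSet (openUnitBall p L : Set L) :=
  (isOpen_lt continuous_norm continuous_const).measurableSet

theorem mem_maximalIdeal_integerRing (x : integerRing p L) :
    x ∈ IsLocalRing.maximalIdeal (integerRing p L) ↔ ‖(x : L)‖ < 1 := by
  rw [IsLocalRing.mem_maximalIdeal, mem_nonunits_iff, ← not_iff_not, not_not, not_lt]
  constructor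
  · rintro ⟨u, rfl⟩
    have h1 : ‖((u : integerRing p L) : L)‖ * ‖((u⁻¹ : (integerRing p L)ˣ) : L)‖ = 1 := by
      rw [← norm_mul, ← MulMemClass.coe_mul, Units.mul_inv]; simp
    have h2 : ‖((u⁻¹ : (integerRing p L)ˣ) : L)‖ ≤ 1 := (u⁻¹ : (integerRing p L)ˣ).1.2
    nlinarith [norm_nonneg ((u : integerRing p L) : L)]
  · intro h
    have h0 : (x : L) ≠ 0 := by
      intro h0; rw [h0, norm_zero] at h; linarith
    refine IsUnit.of_mul_eq_one ⟨(x : L)⁻¹, ?_⟩ ?_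
    · rw [mem_integerRing, norm_inv]; exact inv_le_one_of_one_le₀ h
    · ext; simp [h0]

theorem residueCard_eq_of_surjective {k : Type*} [Field k] (f : integerRing p L →+* k)
    (hf : Function.Surjective f) : residueCard p L = Nat.card k := by
  have hk : RingHom.ker f = IsLocalRing.maximalIdeal (integerRing p L) :=
    IsLocalRing.eq_maximalIdeal (RingHom.ker_isMaximal_of_surjective f hf)
  exact Nat.card_congr ((Ideal.quotEquivOfEq hk.symm).trans
    (RingHom.quotientKerEquivOfSurjective hf)).toEquiv

variable [FiniteDimensional ℚ_[p] L] [MeasurableSpace L] [BorelSpace L]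

instance isAddHaarMeasure_haar : (haar p L).IsAddHaarMeasure := by
  unfold haar; infer_instance

instance regular_haar : (haar p L).Regular := by
  have := properSpace_of_padic p L
  unfold haar; infer_instance

instance sigmaFinite_haar : SigmaFinite (haar p L) := by
  have := properSpace_of_padic p L
  infer_instance

theorem haar_integerRing : haar p L (integerRing p L : Set L) = 1 :=
  Measure.addHaarMeasure_self

theorem eq_haar (μ : Measure L) [SigmaFinite μ] [μ.IsAddLeftInvariant]
    (h : μ (integerRing p L : Set L) = 1) : μ = haar p L := by
  have := properSpace_of_padic p L
  rw [haar, eq_comm, Measure.addHaarMeasure_eq_iff]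
  exact h

theorem haar_openUnitBall_ne_zero : haar p L (openUnitBall p L : Set L) ≠ 0 :=
  (IsOpen.measure_pos _ (isOpen_lt continuous_norm continuous_const) ⟨0, by simp⟩).ne'

/-- The ring of integers is the union of q cosets of its maximal ideal, and has mass 1. -/
theorem residueCard_mul_haar :
    (residueCard p L : ℝ≥0∞) * haar p L (openUnitBall p L : Set L) = 1 := by
  have hle : openUnitBall p L ≤ (integerRing p L).toSubring.toAddSubgroup := fun x hx =>
    (le_of_lt hx : ‖x‖ ≤ 1)
  have h := relIndex_mul_measure (haar p L) hle (measurableSet_openUnitBall p L)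
    (haar_openUnitBall_ne_zero p L) (by
      change haar p L (integerRing p L : Set L) ≠ ∞
      simp [haar_integerRing])
  have h1 : haar p L ((integerRing p L).toSubring.toAddSubgroup : Set L) = 1 :=
    haar_integerRing p L
  rw [h1] at h
  convert h using 3
  rw [residueCard, AddSubgroup.relIndex, AddSubgroup.index]
  have : (Submodule.toAddSubgroup (IsLocalRing.maximalIdeal (integerRing p L))) =
      ((openUnitBall p L).addSubgroupOf (integerRing p L).toSubring.toAddSubgroup :
        AddSubgroup (integerRing p L)) := by
    ext x
    exact mem_maximalIdeal_integerRing p L x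
  rw [← this]
  rfl

theorem residueCard_ne_zero : residueCard p L ≠ 0 := by
  intro h
  simpa [h] using residueCard_mul_haar p L

end OneField

theorem residueCard_padic (p : ℕ) [Fact p.Prime] : residueCard p ℚ_[p] = p := by
  let e : integerRing p ℚ_[p] →+* ℤ_[p] :=
    { toFun := fun x => ⟨x, x.2⟩
      map_one' := rfl
      map_mul' := fun _ _ => rfl
      map_zero' := rfl
      map_add' := fun _ _ => rfl }
  have he : Function.Surjective e := fun x => ⟨⟨x, x.2⟩, rfl⟩
  rw [residueCard_eq_of_surjective p ℚ_[p] ((PadicInt.toZMod (p := p)).comp e)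
    ((ZMod.ringHom_surjective _).comp he), Nat.card_zmod]

/-! ### The norm as modulus of the Haar measure -/

section Scaling

variable (p : ℕ) [Fact p.Prime] (L : Type*) [NormedField L] [NormedAlgebra ℚ_[p] L]

theorem norm_natCast_padic : ‖(p : L)‖ = (p : ℝ)⁻¹ := by
  rw [← map_natCast (algebraMap ℚ_[p] L), norm_algebraMap', Padic.norm_p]

theorem smul_integerRing_of_norm_eq_one {x : L} (hx : ‖x‖ = 1) :
    x • (integerRing p L : Set L) = integerRing p L := by
  have h0 : x ≠ 0 := by intro h; simp [h] at hx
  ext y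
  rw [mem_smul_set_iff_inv_smul_mem₀ h0]
  simp [mem_integerRing, hx]

variable [FiniteDimensional ℚ_[p] L]

/-- The norm of x is the d-th root of the norm of the constant term of its minimal polynomial, d
being the degree. Up to a power, every norm is thus the norm of a power of p. -/
theorem exists_norm_pow_eq_zpow {x : L} (hx : x ≠ 0) :
    ∃ (m : ℕ) (k : ℤ), m ≠ 0 ∧ ‖x‖ ^ m = (p : ℝ) ^ k := by
  have hint : IsIntegral ℚ_[p] x := Algebra.IsIntegral.isIntegral x
  have hc : (minpoly ℚ_[p] x).coeff 0 ≠ 0 := minpoly.coeff_zero_ne_zero hint hx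
  have hd : (minpoly ℚ_[p] x).natDegree ≠ 0 := (minpoly.natDegree_pos hint).ne'
  refine ⟨(minpoly ℚ_[p] x).natDegree, -((minpoly ℚ_[p] x).coeff 0).valuation, hd, ?_⟩
  rw [NormedAlgebra.norm_eq_spectralNorm ℚ_[p] x, spectralNorm.spectralNorm_eq_norm_coeff_zero_rpow,
    ← Real.rpow_natCast, ← Real.rpow_mul (norm_nonneg _), one_div,
    inv_mul_cancel₀ (by exact_mod_cast hd), Real.rpow_one, Padic.norm_eq_zpow_neg_valuation hc]

theorem distribHaarChar_eq_one (p : ℕ) [Fact p.Prime] (L : Type*) [NormedField L]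
    [NormedAlgebra ℚ_[p] L] [FiniteDimensional ℚ_[p] L] [LocallyCompactSpace L] (x : Lˣ)
    (hx : ‖(x : L)‖ = 1) :
    distribHaarChar L x = 1 := by
  borelize L
  refine distribHaarChar_eq_of_measure_smul_eq_mul (μ := haar p L) (s := integerRing p L) ?_ ?_ ?_
  · simp [haar_integerRing]
  · simp [haar_integerRing]
  · rw [Units.smul_def, smul_integerRing_of_norm_eq_one p L hx, ENNReal.coe_one, one_mul]

theorem haar_smul_integerRing_padic [MeasurableSpace ℚ_[p]] [BorelSpace ℚ_[p]] :
    haar p ℚ_[p] ((p : ℚ_[p]) • (integerRing p ℚ_[p] : Set ℚ_[p])) = (p : ℝ≥0∞)⁻¹ := by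
  have hp : (p : ℚ_[p]) ≠ 0 := by exact_mod_cast (Fact.out : p.Prime).ne_zero
  have h1 : (p : ℚ_[p]) • (integerRing p ℚ_[p] : Set ℚ_[p]) = openUnitBall p ℚ_[p] := by
    ext y
    rw [mem_smul_set_iff_inv_smul_mem₀ hp]
    have := Padic.norm_le_pow_iff_norm_lt_pow_add_one y (-1)
    simp only [zpow_neg_one, neg_add_cancel, zpow_zero] at this
    rw [SetLike.mem_coe, SetLike.mem_coe, mem_integerRing, mem_openUnitBall, ← this, smul_eq_mul,
      norm_mul, norm_inv, Padic.norm_p, inv_inv, mul_comm,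
      ← le_div_iff₀ (by exact_mod_cast (Fact.out : p.Prime).pos), one_div]
  have h2 := residueCard_mul_haar p ℚ_[p]
  rw [residueCard_padic] at h2
  rw [h1]
  exact ENNReal.eq_inv_of_mul_eq_one_left (by rwa [mul_comm])

/-- Any Haar measure computes the modulus, so one may use the product measure in a basis over
`ℚ_[p]`, where multiplication by p acts as the scalar p on each coordinate. -/
theorem distribHaarChar_natCast [LocallyCompactSpace L] (x : Lˣ) (hx : (x : L) = p) :
    distribHaarChar L x = ((p : ℝ≥0)⁻¹) ^ finrank ℚ_[p] L := by
  borelize L ℚ_[p]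
  have hp : (p : ℚ_[p]) ≠ 0 := by exact_mod_cast (Fact.out : p.Prime).ne_zero
  let e : (Fin (finrank ℚ_[p] L) → ℚ_[p]) ≃L[ℚ_[p]] L :=
    (finBasis ℚ_[p] L).equivFun.symm.toContinuousLinearEquiv
  let μ : Measure (Fin (finrank ℚ_[p] L) → ℚ_[p]) := Measure.pi fun _ => haar p ℚ_[p]
  have hν : (μ.map e).IsAddHaarMeasure := e.isAddHaarMeasure_map μ
  have hL := properSpace_of_padic p L
  let s : Set (Fin (finrank ℚ_[p] L) → ℚ_[p]) :=
    Set.pi univ fun _ => (integerRing p ℚ_[p] : Set ℚ_[p])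
  have he (t : Set (Fin (finrank ℚ_[p] L) → ℚ_[p])) : μ.map e (e '' t) = μ t := by
    have := e.toHomeomorph.toMeasurableEquiv.map_apply (μ := μ) (e '' t)
    exact this.trans (by
      congr 1
      exact e.injective.preimage_image t)
  have hs : μ s = 1 := by
    simp only [μ, s, Measure.pi_pi, haar_integerRing, Finset.prod_const_one]
  have hsmul : x • (e '' s) = e '' ((p : ℚ_[p]) • s) := by
    ext y
    simp only [Set.mem_smul_set, mem_image, Units.smul_def, hx]
    constructor
    · rintro ⟨_, ⟨z, hz, rfl⟩, rfl⟩
      refine ⟨_, ⟨z, hz, rfl⟩, ?_⟩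
      rw [map_smul, Algebra.smul_def, map_natCast, smul_eq_mul]
    · rintro ⟨_, ⟨z, hz, rfl⟩, rfl⟩
      refine ⟨_, ⟨z, hz, rfl⟩, ?_⟩
      change (p : L) * e z = _
      rw [map_smul, Algebra.smul_def, map_natCast]
  refine distribHaarChar_eq_of_measure_smul_eq_mul (μ := μ.map e) (s := e '' s) ?_ ?_ ?_
  · simp [he, hs]
  · simp [he, hs]
  · rw [hsmul, he, he, hs, mul_one]
    simp only [s, μ]
    rw [Set.smul_set_univ_pi]
    rw [Measure.pi_pi]
    simp only [Pi.smul_apply, haar_smul_integerRing_padic, Finset.prod_const, Finset.card_univ,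
      Fintype.card_fin]
    rw [ENNReal.coe_pow, ENNReal.coe_inv (by exact_mod_cast (Fact.out : p.Prime).ne_zero)]
    simp

theorem distribHaarChar_eq_norm_pow [LocallyCompactSpace L] (x : Lˣ) :
    distribHaarChar L x = ‖(x : L)‖₊ ^ finrank ℚ_[p] L := by
  obtain ⟨m, k, hm, hk⟩ := exists_norm_pow_eq_zpow p L x.ne_zero
  have hp : (p : L) ≠ 0 := by
    rw [← norm_pos_iff, norm_natCast_padic]
    exact inv_pos.mpr (by exact_mod_cast (Fact.out : p.Prime).pos)
  let y : Lˣ := Units.mk0 (p : L) hp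
  -- The element x^m p^k has norm 1, so it preserves the ring of integers and has modulus 1. As the
  -- modulus of p is known, this determines the m-th power of the modulus of x, hence the modulus
  -- itself.
  have h1 : distribHaarChar L (x ^ m * y ^ k) = 1 := by
    refine distribHaarChar_eq_one p L _ ?_
    have : (p : ℝ) ^ k ≠ 0 := zpow_ne_zero _ (by exact_mod_cast (Fact.out : p.Prime).ne_zero)
    simp [y, hk, norm_natCast_padic, this]
  rw [map_mul, map_pow, map_zpow, distribHaarChar_natCast p L y rfl] at h1
  have h2 : (‖(x : L)‖₊ ^ finrank ℚ_[p] L) ^ m * (((p : ℝ≥0)⁻¹) ^ finrank ℚ_[p] L) ^ k = 1 := by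
    ext
    push_cast
    rw [pow_right_comm, hk, ← zpow_natCast, ← zpow_natCast, inv_zpow, inv_zpow,
      ← zpow_mul, ← zpow_mul, mul_comm k]
    exact mul_inv_cancel₀ (zpow_ne_zero _ (by exact_mod_cast (Fact.out : p.Prime).ne_zero))
  have h3 : distribHaarChar L x ^ m = (‖(x : L)‖₊ ^ finrank ℚ_[p] L) ^ m :=
    mul_right_cancel₀ (right_ne_zero_of_mul_eq_one h2) (h1.trans h2.symm)
  exact pow_left_injective hm h3

variable [MeasurableSpace L] [BorelSpace L]

theorem haar_smul {x : L} (hx : x ≠ 0) (s : Set L) :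
    haar p L (x • s) = ENNReal.ofReal (‖x‖ ^ finrank ℚ_[p] L) * haar p L s := by
  have hL := properSpace_of_padic p L
  have := distribHaarChar_mul (haar p L) (Units.mk0 x hx) s
  rw [distribHaarChar_eq_norm_pow p L] at this
  rw [show x • s = Units.mk0 x hx • s from rfl, ← this]
  congr 1
  rw [ENNReal.ofReal_pow (norm_nonneg _), ENNReal.coe_pow, ofReal_norm]
  rfl

theorem map_mul_left_haar {x : L} (hx : x ≠ 0) :
    (haar p L).map (x * ·) = ENNReal.ofReal ((‖x‖ ^ finrank ℚ_[p] L)⁻¹) • haar p L := by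
  ext s hs
  rw [Measure.map_apply (by fun_prop) hs, Measure.smul_apply, smul_eq_mul]
  have : (x * ·) ⁻¹' s = x⁻¹ • s := by
    ext y; rw [mem_smul_set_iff_inv_smul_mem₀ (inv_ne_zero hx), inv_inv]; rfl
  rw [this, haar_smul p L (inv_ne_zero hx), norm_inv, inv_pow]

/-- The value of the normalized absolute value of `L` at any uniformizer is `q⁻¹`. -/
theorem residueCard_mul_norm_pow {ϖ : L} (h0 : ϖ ≠ 0) (h : ∀ x : L, ‖x‖ < 1 ↔ ‖x‖ ≤ ‖ϖ‖) :
    (residueCard p L : ℝ) * ‖ϖ‖ ^ finrank ℚ_[p] L = 1 := by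
  have h1 : (openUnitBall p L : Set L) = ϖ • (integerRing p L : Set L) := by
    ext x
    rw [mem_smul_set_iff_inv_smul_mem₀ h0, SetLike.mem_coe, SetLike.mem_coe, mem_openUnitBall,
      mem_integerRing, h, smul_eq_mul, norm_mul, norm_inv, inv_mul_le_iff₀ (norm_pos_iff.mpr h0),
      mul_one]
  have h2 := residueCard_mul_haar p L
  rw [h1, haar_smul p L h0, haar_integerRing, mul_one] at h2
  have := congrArg ENNReal.toReal h2
  simpa using this

end Scaling

/-! ### Change of variables under inversion, and self-similarity -/

/-- A measure on a field which is invariant under multiplication by nonzero elements, and for which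
`0` is negligible, is invariant under inversion. -/
theorem lintegral_inv_eq_of_mul_invariant {L : Type*} [Field L] [MeasurableSpace L]
    [MeasurableMul₂ L] [MeasurableInv L] (ν : Measure L) [SFinite ν]
    (hν : ∀ c : L, c ≠ 0 → ∀ f : L → ℝ≥0∞, Measurable f → ∫⁻ x, f (c * x) ∂ν = ∫⁻ x, f x ∂ν)
    (h0 : ∀ᵐ x ∂ν, x ≠ 0) (U : Set L) (hU : MeasurableSet U) (hU0 : ν U ≠ 0) (hU1 : ν U ≠ ∞)
    (f : L → ℝ≥0∞) (hf : Measurable f) : ∫⁻ x, f x⁻¹ ∂ν = ∫⁻ x, f x ∂ν := by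
  have hχ : Measurable (U.indicator (1 : L → ℝ≥0∞)) := measurable_one.indicator hU
  have hχU : ∫⁻ y, U.indicator (1 : L → ℝ≥0∞) y ∂ν = ν U := by simp [lintegral_indicator hU]
  have hfi : Measurable fun x => f x⁻¹ := hf.comp measurable_inv
  -- The double integral of f(x⁻¹)1_U(xy) is evaluated in both orders: integrating first in y gives
  -- the left side, while replacing xy by x turns the integrand into f(x⁻¹y)1_U(x). The set `U`
  -- serves only to supply a finite nonzero factor to cancel.
  have key : (∫⁻ x, f x⁻¹ ∂ν) * ν U = (∫⁻ x, f x ∂ν) * ν U := by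
    calc (∫⁻ x, f x⁻¹ ∂ν) * ν U
        = ∫⁻ x, ∫⁻ y, f x⁻¹ * U.indicator 1 (x * y) ∂ν ∂ν := by
          rw [← lintegral_mul_const _ hfi]
          refine lintegral_congr_ae ?_
          filter_upwards [h0] with x hx
          rw [hν x hx (fun z => f x⁻¹ * U.indicator 1 z) (hχ.const_mul _),
            lintegral_const_mul _ hχ, hχU]
      _ = ∫⁻ y, ∫⁻ x, f x⁻¹ * U.indicator 1 (x * y) ∂ν ∂ν := by
          rw [lintegral_lintegral_swap]
          exact ((hf.comp (measurable_inv.comp measurable_fst)).mul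
            (hχ.comp measurable_mul)).aemeasurable
      _ = ∫⁻ y, ∫⁻ x, f (x⁻¹ * y) * U.indicator 1 x ∂ν ∂ν := by
          refine lintegral_congr_ae ?_
          filter_upwards [h0] with y hy
          rw [← hν y hy (fun x => f (x⁻¹ * y) * U.indicator 1 x)
            ((hf.comp (measurable_inv.mul_const y)).mul hχ)]
          refine lintegral_congr fun x => ?_
          have : (y * x)⁻¹ * y = x⁻¹ := by
            rw [mul_inv, mul_right_comm, inv_mul_cancel₀ hy, one_mul]
          rw [this, mul_comm y x]
      _ = ∫⁻ x, ∫⁻ y, f (x⁻¹ * y) * U.indicator 1 x ∂ν ∂ν := by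
          rw [lintegral_lintegral_swap]
          exact ((hf.comp ((measurable_inv.comp measurable_snd).mul measurable_fst)).mul
            (hχ.comp measurable_snd)).aemeasurable
      _ = ∫⁻ x, (∫⁻ y, f y ∂ν) * U.indicator 1 x ∂ν := by
          refine lintegral_congr_ae ?_
          filter_upwards [h0] with x hx
          rw [hν x⁻¹ (inv_ne_zero hx) (fun y => f y * U.indicator 1 x) (hf.mul_const _),
            lintegral_mul_const _ hf]
      _ = (∫⁻ x, f x ∂ν) * ν U := by rw [lintegral_const_mul _ hχ, hχU]
  exact (ENNReal.mul_left_inj hU0 hU1).mp key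

section OneField

variable (p : ℕ) [Fact p.Prime] (L : Type*) [NormedField L] [NormedAlgebra ℚ_[p] L]
  [FiniteDimensional ℚ_[p] L]

theorem exists_uniformizer (p : ℕ) [Fact p.Prime] (L : Type*) [NormedField L]
    [NormedAlgebra ℚ_[p] L] [FiniteDimensional ℚ_[p] L] :
    ∃ ϖ : L, ϖ ≠ 0 ∧ ‖ϖ‖ < 1 ∧ ∀ x : L, ‖x‖ < 1 ↔ ‖x‖ ≤ ‖ϖ‖ := by
  obtain ⟨ϖ, hϖ⟩ := (IsPrincipalIdealRing.principal
    (IsLocalRing.maximalIdeal (integerRing p L))).principal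
  have hlt : ‖(ϖ : L)‖ < 1 := by
    rw [← mem_maximalIdeal_integerRing, hϖ]; exact Submodule.mem_span_singleton_self ϖ
  have hle (x : L) (hx : ‖x‖ < 1) : ∃ a : L, ‖a‖ ≤ 1 ∧ a * ϖ = x := by
    have : (⟨x, hx.le⟩ : integerRing p L) ∈ IsLocalRing.maximalIdeal (integerRing p L) := by
      rwa [mem_maximalIdeal_integerRing]
    rw [hϖ, Submodule.mem_span_singleton] at this
    obtain ⟨a, ha⟩ := this
    exact ⟨a, a.2, congrArg Subtype.val ha⟩
  refine ⟨ϖ, ?_, hlt, fun x => ⟨fun hx => ?_, fun hx => hx.trans_lt hlt⟩⟩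
  · intro h0
    have hp : ‖(p : L)‖ < 1 := by
      rw [norm_natCast_padic]
      exact inv_lt_one_of_one_lt₀ (by exact_mod_cast (Fact.out : p.Prime).one_lt)
    obtain ⟨a, -, ha⟩ := hle p hp
    have : ‖(p : L)‖ = 0 := by rw [← ha, h0, mul_zero, norm_zero]
    rw [norm_natCast_padic] at this
    exact (inv_ne_zero (by exact_mod_cast (Fact.out : p.Prime).ne_zero)) this
  · obtain ⟨a, ha, rfl⟩ := hle x hx
    rw [norm_mul]
    exact mul_le_of_le_one_left (norm_nonneg _) ha

variable [MeasurableSpace L] [BorelSpace L]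

/-- Multiplication by p fixes {0} and multiplies its finite mass by a factor less than 1. -/
theorem haar_singleton_zero : haar p L {0} = 0 := by
  have hp0 : (p : L) ≠ 0 := by
    rw [← norm_pos_iff, norm_natCast_padic]
    exact inv_pos.mpr (by exact_mod_cast (Fact.out : p.Prime).pos)
  have h := haar_smul p L hp0 {0}
  rw [smul_set_singleton, smul_zero] at h
  have hfin : haar p L {0} ≠ ∞ := isCompact_singleton.measure_ne_top
  have hlt : ‖(p : L)‖ ^ finrank ℚ_[p] L < 1 := by
    refine pow_lt_one₀ (norm_nonneg _) ?_ (finrank_pos).ne'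
    rw [norm_natCast_padic]
    exact inv_lt_one_of_one_lt₀ (by exact_mod_cast (Fact.out : p.Prime).one_lt)
  have h2 := congrArg ENNReal.toReal h
  rw [ENNReal.toReal_mul, ENNReal.toReal_ofReal (by positivity)] at h2
  have h3 : (haar p L {0}).toReal = 0 := by
    have : (1 - ‖(p : L)‖ ^ finrank ℚ_[p] L) * (haar p L {0}).toReal = 0 := by linarith
    exact (mul_eq_zero.mp this).resolve_left (by linarith)
  exact (ENNReal.toReal_eq_zero_iff _).mp h3 |>.resolve_right hfin

theorem ae_ne_zero_haar : ∀ᵐ x ∂(haar p L), x ≠ 0 := by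
  rw [ae_iff]; simpa using haar_singleton_zero p L

theorem lintegral_comp_mul_left_haar {c : L} (hc : c ≠ 0) (f : L → ℝ≥0∞) :
    ∫⁻ x, f (c * x) ∂(haar p L) =
      ENNReal.ofReal ((‖c‖ ^ finrank ℚ_[p] L)⁻¹) * ∫⁻ x, f x ∂(haar p L) := by
  rw [← smul_eq_mul, ← lintegral_smul_measure, ← map_mul_left_haar p L hc]
  exact ((measurableEmbedding_mulLeft₀ hc).lintegral_map f).symm

theorem integral_comp_mul_left_haar {c : L} (hc : c ≠ 0) (f : L → ℝ) :
    ∫ x, f (c * x) ∂(haar p L) = (‖c‖ ^ finrank ℚ_[p] L)⁻¹ * ∫ x, f x ∂(haar p L) := by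
  rw [← (measurableEmbedding_mulLeft₀ hc).integral_map f, map_mul_left_haar p L hc,
    integral_smul_measure, ENNReal.toReal_ofReal (by positivity), smul_eq_mul]

/-- The Haar measure of the multiplicative group of `L`, as a measure on `L`. -/
def mulHaar : Measure L :=
  (haar p L).withDensity fun x => ENNReal.ofReal ((‖x‖ ^ finrank ℚ_[p] L)⁻¹)

theorem lintegral_mulHaar (f : L → ℝ≥0∞) (hf : Measurable f) : ∫⁻ x, f x ∂(mulHaar p L) =
    ∫⁻ x, ENNReal.ofReal ((‖x‖ ^ finrank ℚ_[p] L)⁻¹) * f x ∂(haar p L) := by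
  rw [mulHaar, lintegral_withDensity_eq_lintegral_mul _ (by fun_prop) hf]
  rfl

theorem lintegral_inv_mulHaar (f : L → ℝ≥0∞) (hf : Measurable f) :
    ∫⁻ x, f x⁻¹ ∂(mulHaar p L) = ∫⁻ x, f x ∂(mulHaar p L) := by
  have := properSpace_of_padic p L
  have := isUltrametricDist_of_padic p L
  have : SFinite (mulHaar p L) := by unfold mulHaar; infer_instance
  have hU : IsOpen {x : L | ‖x‖ = 1} := by
    convert IsUltrametricDist.isOpen_sphere (0 : L) one_ne_zero using 1
    ext; simp
  have hν : mulHaar p L {x : L | ‖x‖ = 1} = haar p L {x : L | ‖x‖ = 1} := by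
    rw [mulHaar, withDensity_apply _ hU.measurableSet,
      setLIntegral_congr_fun hU.measurableSet (g := fun _ => 1)]
    · simp
    · intro x hx
      simp [show ‖x‖ = 1 from hx]
  refine lintegral_inv_eq_of_mul_invariant _ (fun c hc f hf => ?_) ?_ {x : L | ‖x‖ = 1}
    hU.measurableSet ?_ ?_ f hf
  · have hfc : Measurable fun x => f (c * x) := hf.comp (measurable_const_mul c)
    rw [lintegral_mulHaar p L _ hf, lintegral_mulHaar p L _ hfc]
    have h := lintegral_comp_mul_left_haar p L hc
      (fun x => ENNReal.ofReal ((‖x‖ ^ finrank ℚ_[p] L)⁻¹) * f x)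
    have hc' : 0 < (‖c‖ ^ finrank ℚ_[p] L)⁻¹ := by
      have := norm_pos_iff.mpr hc
      positivity
    refine (ENNReal.mul_right_inj (ENNReal.ofReal_pos.mpr hc').ne' ENNReal.ofReal_ne_top).mp ?_
    rw [← h, ← lintegral_const_mul]
    · refine lintegral_congr fun x => ?_
      rw [← mul_assoc, ← ENNReal.ofReal_mul hc'.le, norm_mul, mul_pow, mul_inv]
    · fun_prop
  · rw [mulHaar]
    exact (withDensity_absolutelyContinuous _ _).ae_le (ae_ne_zero_haar p L)
  · rw [hν]
    exact (hU.measure_pos _ ⟨1, by simp⟩).ne'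
  · rw [hν]
    refine ((measure_mono ?_).trans_lt ((haar_integerRing p L).trans_lt ENNReal.one_lt_top)).ne
    intro x (hx : ‖x‖ = 1)
    exact hx.le

theorem map_inv_haar : ((haar p L).withDensity fun x =>
      {x : L | 1 < ‖x‖}.indicator
        (fun x => ENNReal.ofReal ((‖x‖ ^ (2 * finrank ℚ_[p] L))⁻¹)) x).map (·⁻¹) =
    (haar p L).restrict {x : L | ‖x‖ < 1} := by
  have hgt : MeasurableSet {x : L | 1 < ‖x‖} := measurableSet_lt measurable_const measurable_norm
  have hlt : MeasurableSet {x : L | ‖x‖ < 1} := measurableSet_lt measurable_norm measurable_const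
  refine Measure.ext_of_lintegral _ fun f hf => ?_
  have hfi : Measurable fun x => f x⁻¹ := hf.comp measurable_inv
  rw [lintegral_map hf measurable_inv, lintegral_withDensity_eq_lintegral_mul _
    (Measurable.indicator (by fun_prop) hgt) hfi]
  -- With d = [L : ℚ_p], the measure ‖x‖^(-d)dx is invariant under inversion. Applied to ‖y‖^d f(y)
  -- on ‖y‖ < 1, this yields the density ‖x‖^(-2d) on ‖x‖ > 1: one factor ‖x‖^(-d) from the test
  -- function, one from the measure.
  have hm : Measurable fun y : L =>
      {y : L | ‖y‖ < 1}.indicator (fun y => ENNReal.ofReal (‖y‖ ^ finrank ℚ_[p] L) * f y) y :=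
    Measurable.indicator (by fun_prop) hlt
  have h := lintegral_inv_mulHaar p L _ hm
  rw [lintegral_mulHaar p L _ hm] at h
  erw [lintegral_mulHaar p L _ (hm.comp measurable_inv)] at h
  rw [← lintegral_indicator hlt]
  refine Eq.trans (lintegral_congr_ae ?_) (h.trans (lintegral_congr_ae ?_))
  · filter_upwards [ae_ne_zero_haar p L] with x hx
    have hx' := norm_pos_iff.mpr hx
    by_cases h1 : 1 < ‖x‖
    · have h2 : ‖x⁻¹‖ < 1 := by rw [norm_inv]; exact inv_lt_one_of_one_lt₀ h1
      simp only [Pi.mul_apply, indicator, mem_ofPred_eq, h1, h2, if_true, Function.comp]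
      rw [← mul_assoc, ← ENNReal.ofReal_mul (by positivity), norm_inv, inv_pow, ← mul_inv,
        ← pow_add, two_mul]
    · have h2 : ¬ ‖x⁻¹‖ < 1 := by
        rw [norm_inv, not_lt]; exact (one_le_inv₀ hx').mpr (not_lt.mp h1)
      simp only [Pi.mul_apply, indicator, mem_ofPred_eq, h1, h2, if_false, Function.comp, zero_mul,
        mul_zero]
  · filter_upwards [ae_ne_zero_haar p L] with x hx
    have hx' := norm_pos_iff.mpr hx
    by_cases h1 : ‖x‖ < 1
    · simp only [indicator, mem_ofPred_eq, h1, if_true]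
      rw [← mul_assoc, ← ENNReal.ofReal_mul (by positivity), inv_mul_cancel₀ (by positivity)]
      simp
    · simp [indicator, h1]

theorem integrableOn_inv (g : L → ℝ) (hg : IntegrableOn g {x : L | ‖x‖ < 1} (haar p L)) :
    IntegrableOn (fun x => (‖x‖ ^ (2 * finrank ℚ_[p] L))⁻¹ * g x⁻¹) {x : L | 1 < ‖x‖}
      (haar p L) := by
  have hgt : MeasurableSet {x : L | 1 < ‖x‖} := measurableSet_lt measurable_const measurable_norm
  have he : MeasurableEmbedding fun x : L => x⁻¹ := (MeasurableEquiv.inv L).measurableEmbedding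
  rw [IntegrableOn, ← map_inv_haar p L, he.integrable_map_iff,
    integrable_withDensity_iff_integrable_smul' (Measurable.indicator (by fun_prop) hgt)] at hg
  · rw [← integrable_indicator_iff hgt]
    refine hg.congr (Filter.Eventually.of_forall fun x => ?_)
    by_cases hx : 1 < ‖x‖ <;> simp [indicator, hx]
  · refine Filter.Eventually.of_forall fun x => ?_
    by_cases hx : 1 < ‖x‖ <;> simp [indicator, hx]

theorem integral_inv (g : L → ℝ) :
    ∫ x in {x : L | 1 < ‖x‖}, (‖x‖ ^ (2 * finrank ℚ_[p] L))⁻¹ * g x⁻¹ ∂(haar p L) =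
      ∫ x in {x : L | ‖x‖ < 1}, g x ∂(haar p L) := by
  have hgt : MeasurableSet {x : L | 1 < ‖x‖} := measurableSet_lt measurable_const measurable_norm
  have he : MeasurableEmbedding fun x : L => x⁻¹ := (MeasurableEquiv.inv L).measurableEmbedding
  rw [← map_inv_haar p L, ← integral_indicator hgt, he.integral_map,
    integral_withDensity_eq_integral_toReal_smul (Measurable.indicator (by fun_prop) hgt)]
  · refine integral_congr_ae (Filter.Eventually.of_forall fun x => ?_)
    by_cases hx : 1 < ‖x‖ <;> simp [indicator, hx]
  · refine Filter.Eventually.of_forall fun x => ?_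
    by_cases hx : 1 < ‖x‖ <;> simp [indicator, hx]

theorem setIntegral_openUnitBall_eq {ϖ : L} (h0 : ϖ ≠ 0) (h : ∀ x : L, ‖x‖ < 1 ↔ ‖x‖ ≤ ‖ϖ‖)
    (f : L → ℝ) :
    ∫ x in (openUnitBall p L : Set L), f x ∂(haar p L) =
      (residueCard p L : ℝ)⁻¹ * ∫ x in (integerRing p L : Set L), f (ϖ * x) ∂(haar p L) := by
  have hq := residueCard_mul_norm_pow p L h0 h
  have hϖ : ‖ϖ‖ ^ finrank ℚ_[p] L ≠ 0 := pow_ne_zero _ (norm_ne_zero_iff.mpr h0)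
  rw [eq_inv_of_mul_eq_one_left hq, inv_inv, ← integral_indicator (measurableSet_openUnitBall p L),
    ← integral_indicator (measurableSet_integerRing p L)]
  have := integral_comp_mul_left_haar p L h0 ((openUnitBall p L : Set L).indicator f)
  rw [inv_mul_eq_div, eq_div_iff hϖ, mul_comm] at this
  rw [← this]
  congr 1
  refine integral_congr_ae (Filter.Eventually.of_forall fun x => ?_)
  have : ϖ * x ∈ (openUnitBall p L : Set L) ↔ x ∈ (integerRing p L : Set L) := by
    rw [SetLike.mem_coe, SetLike.mem_coe, mem_openUnitBall, mem_integerRing, h, norm_mul,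
      mul_le_iff_le_one_right (norm_pos_iff.mpr h0)]
  by_cases hx : x ∈ (integerRing p L : Set L)
  · simp only [indicator, hx, this.mpr hx, if_true]
  · simp only [indicator, hx, mt this.mp hx, if_false]

/-- Self-similarity of the ring of integers: `𝒪_L` is the union of its group of units and of
`ϖ 𝒪_L`. -/
theorem integral_integerRing_eq {ϖ : L} (h0 : ϖ ≠ 0) (h : ∀ x : L, ‖x‖ < 1 ↔ ‖x‖ ≤ ‖ϖ‖)
    (f : L → ℝ) (hf : IntegrableOn f (integerRing p L) (haar p L)) (c : ℝ)
    (hc : ∀ x, ‖x‖ = 1 → f x = c) :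
    ∫ x in (integerRing p L : Set L), f x ∂(haar p L) = (1 - (residueCard p L : ℝ)⁻¹) * c +
      (residueCard p L : ℝ)⁻¹ * ∫ x in (integerRing p L : Set L), f (ϖ * x) ∂(haar p L) := by
  have hsub : (openUnitBall p L : Set L) ⊆ (integerRing p L : Set L) :=
    fun x hx => (le_of_lt hx : ‖x‖ ≤ 1)
  have hm := measurableSet_openUnitBall p L
  have hq0 : (residueCard p L : ℝ≥0∞) ≠ 0 := by exact_mod_cast residueCard_ne_zero p L
  have hμ : haar p L (openUnitBall p L : Set L) = (residueCard p L : ℝ≥0∞)⁻¹ :=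
    ENNReal.eq_inv_of_mul_eq_one_left ((mul_comm _ _).trans (residueCard_mul_haar p L))
  have hunits : ∫ x in (integerRing p L : Set L) \ openUnitBall p L, f x ∂(haar p L) =
      (1 - (residueCard p L : ℝ)⁻¹) * c := by
    rw [setIntegral_congr_fun ((measurableSet_integerRing p L).diff hm) (g := fun _ => c),
      setIntegral_const, measureReal_def, measure_sdiff hsub hm.nullMeasurableSet, hμ,
      haar_integerRing, ENNReal.toReal_sub_of_le, smul_eq_mul]
    · simp
    · rw [ENNReal.inv_le_one]
      exact_mod_cast Nat.one_le_iff_ne_zero.mpr (residueCard_ne_zero p L)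
    · simp
    · simp [hμ, hq0]
    · intro x hx
      exact hc x (le_antisymm hx.1 (not_lt.mp hx.2))
  rw [← setIntegral_openUnitBall_eq p L h0 h, ← hunits, setIntegral_sdiff hm hf hsub]
  ring

end OneField

/-! ### Moments of the norm and the integrals of maxima over 𝒪_F -/

section OneField

variable (p : ℕ) [Fact p.Prime] (F : Type*) [NormedField F] [NormedAlgebra ℚ_[p] F]

section pnorm

variable {L : Type*} [NormedField L]

theorem pnorm_nonneg (x : L) : 0 ≤ pnorm p F x := pow_nonneg (norm_nonneg _) _

theorem pnorm_mul (x y : L) : pnorm p F (x * y) = pnorm p F x * pnorm p F y := by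
  simp [pnorm, mul_pow]

theorem pnorm_eq_one {x : L} (hx : ‖x‖ = 1) : pnorm p F x = 1 := by
  simp [pnorm, hx]

theorem continuous_pnorm : Continuous (pnorm p F : L → ℝ) := continuous_norm.pow _

variable [FiniteDimensional ℚ_[p] F]

theorem finrank_padic_ne_zero : finrank ℚ_[p] F ≠ 0 := finrank_pos.ne'

theorem pnorm_le_one_iff {x : L} : pnorm p F x ≤ 1 ↔ ‖x‖ ≤ 1 :=
  pow_le_one_iff_of_nonneg (norm_nonneg _) (finrank_padic_ne_zero p F)

theorem pnorm_lt_one_iff {x : L} : pnorm p F x < 1 ↔ ‖x‖ < 1 :=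
  pow_lt_one_iff_of_nonneg (norm_nonneg _) (finrank_padic_ne_zero p F)

theorem pnorm_eq_zero_iff {x : L} : pnorm p F x = 0 ↔ x = 0 := by
  rw [pnorm, pow_eq_zero_iff (finrank_padic_ne_zero p F), norm_eq_zero]

theorem pnorm_pos_iff {x : L} : 0 < pnorm p F x ↔ x ≠ 0 := by
  rw [(pnorm_nonneg p F x).lt_iff_ne', Ne, pnorm_eq_zero_iff]

end pnorm

variable [FiniteDimensional ℚ_[p] F]

section Uniformizer

variable [MeasurableSpace F] [BorelSpace F]

theorem pnorm_uniformizer {ϖ : F} (h0 : ϖ ≠ 0) (h : ∀ x : F, ‖x‖ < 1 ↔ ‖x‖ ≤ ‖ϖ‖) :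
    pnorm p F ϖ = (residueCard p F : ℝ)⁻¹ :=
  eq_inv_of_mul_eq_one_right (residueCard_mul_norm_pow p F h0 h)

theorem one_lt_residueCard : (1 : ℝ) < residueCard p F := by
  obtain ⟨ϖ, h0, h1, h⟩ := exists_uniformizer p F
  have h2 := (pnorm_lt_one_iff p F).mpr h1
  rw [pnorm_uniformizer p F h0 h] at h2
  have h3 : (0 : ℝ) < residueCard p F := by
    exact_mod_cast Nat.pos_of_ne_zero (residueCard_ne_zero p F)
  exact (inv_lt_one₀ h3).mp h2

/-- The Haar probability measure of the ring of integers of `F`, as a measure on `F`. -/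
abbrev intHaar : Measure F := (haar p F).restrict (integerRing p F : Set F)

instance : IsProbabilityMeasure (intHaar p F) :=
  ⟨by rw [Measure.restrict_apply_univ, haar_integerRing]⟩

theorem ae_mem_integerRing : ∀ᵐ x ∂(intHaar p F), ‖x‖ ≤ 1 :=
  ae_restrict_mem (measurableSet_integerRing p F)

theorem isCompact_integerRing (p : ℕ) [Fact p.Prime] (F : Type*) [NormedField F]
    [NormedAlgebra ℚ_[p] F] [FiniteDimensional ℚ_[p] F] :
    IsCompact (integerRing p F : Set F) := by
  have := properSpace_of_padic p F
  rw [coe_integerRing]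
  exact isCompact_closedBall 0 1

theorem integrable_intHaar {f : F → ℝ} (hf : Continuous f) : Integrable f (intHaar p F) :=
  hf.continuousOn.integrableOn_compact (isCompact_integerRing p F)

theorem integrable_intHaar_prod {f : F × F → ℝ} (hf : Continuous f) :
    Integrable f ((intHaar p F).prod (intHaar p F)) := by
  have := properSpace_of_padic p F
  rw [Measure.prod_restrict]
  exact hf.continuousOn.integrableOn_compact
    ((isCompact_integerRing p F).prod (isCompact_integerRing p F))

theorem integrable_intHaar_prod_prod {f : F × F × F → ℝ} (hf : Continuous f) :
    Integrable f ((intHaar p F).prod ((intHaar p F).prod (intHaar p F))) := by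
  have := properSpace_of_padic p F
  rw [Measure.prod_restrict, Measure.prod_restrict]
  exact hf.continuousOn.integrableOn_compact
    ((isCompact_integerRing p F).prod
      ((isCompact_integerRing p F).prod (isCompact_integerRing p F)))

theorem integral_intHaar_eq {ϖ : F} (h0 : ϖ ≠ 0) (h : ∀ x : F, ‖x‖ < 1 ↔ ‖x‖ ≤ ‖ϖ‖)
    {f : F → ℝ} (hf : Integrable f (intHaar p F)) {c : ℝ} (hc : ∀ x, ‖x‖ = 1 → f x = c) :
    ∫ x, f x ∂(intHaar p F) = (1 - (residueCard p F : ℝ)⁻¹) * c +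
      (residueCard p F : ℝ)⁻¹ * ∫ x, f (ϖ * x) ∂(intHaar p F) :=
  integral_integerRing_eq p F h0 h f hf c hc

/-- Self-similarity: the integral I satisfies I = (1 - r) + r · r^s I with r = 1/q. -/
theorem integral_pnorm_pow (s : ℕ) : ∫ x : F, pnorm p F x ^ s ∂(intHaar p F) =
    (1 - (residueCard p F : ℝ)⁻¹) / (1 - ((residueCard p F : ℝ)⁻¹) ^ (s + 1)) := by
  obtain ⟨ϖ, h0, h1, h⟩ := exists_uniformizer p F
  have hint : Integrable (fun x : F => pnorm p F x ^ s) (intHaar p F) :=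
    integrable_intHaar p F ((continuous_pnorm p F).pow s)
  have h2 := integral_intHaar_eq p F h0 h hint (c := 1)
    (fun x hx => by rw [pnorm_eq_one p F hx, one_pow])
  simp only [pnorm_mul, mul_pow, pnorm_uniformizer p F h0 h, integral_const_mul] at h2
  have hq := one_lt_residueCard p F
  have hlt : ((residueCard p F : ℝ)⁻¹) ^ (s + 1) < 1 :=
    pow_lt_one₀ (by positivity) (inv_lt_one_of_one_lt₀ hq) (by lia)
  rw [eq_div_iff (by linarith)]
  rw [pow_succ]
  linarith

/-- The integral over `𝒪_F²` of `max ‖u‖² (κ t² ‖v‖²)`. -/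
def maxIntegral (κ t : ℝ) : ℝ :=
  ∫ w : F × F, max (pnorm p F w.1 ^ 2) (κ * t ^ 2 * pnorm p F w.2 ^ 2)
    ∂((intHaar p F).prod (intHaar p F))

theorem continuous_max_pnorm (p : ℕ) [Fact p.Prime] (F : Type*) [NormedField F]
    [NormedAlgebra ℚ_[p] F] (κ t : ℝ) : Continuous fun w : F × F =>
    max (pnorm p F w.1 ^ 2) (κ * t ^ 2 * pnorm p F w.2 ^ 2) :=
  (((continuous_pnorm p F).comp continuous_fst).pow 2).max
    (continuous_const.mul (((continuous_pnorm p F).comp continuous_snd).pow 2))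

theorem maxIntegral_eq_integral (κ t : ℝ) : maxIntegral p F κ t =
    ∫ u : F, ∫ v : F, max (pnorm p F u ^ 2) (κ * t ^ 2 * pnorm p F v ^ 2)
      ∂(intHaar p F) ∂(intHaar p F) :=
  integral_prod _ (integrable_intHaar_prod p F (continuous_max_pnorm p F κ t))

/-- Self-similarity in the first variable alone: when it is a unit, the bound on κt² makes the
maximum equal to 1. -/
theorem maxIntegral_split {κ t : ℝ} (hκ : 0 ≤ κ) (ht : κ * t ^ 2 ≤ 1) :
    maxIntegral p F κ t = (1 - (residueCard p F : ℝ)⁻¹) + (residueCard p F : ℝ)⁻¹ *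
      ∫ w : F × F, max (((residueCard p F : ℝ)⁻¹) ^ 2 * pnorm p F w.1 ^ 2)
        (κ * t ^ 2 * pnorm p F w.2 ^ 2) ∂((intHaar p F).prod (intHaar p F)) := by
  obtain ⟨ϖ, h0, h1, h⟩ := exists_uniformizer p F
  have hint := integrable_intHaar_prod p F (continuous_max_pnorm p F κ t)
  rw [maxIntegral_eq_integral, integral_intHaar_eq p F h0 h hint.integral_prod_left (c := 1),
    mul_one, integral_prod]
  · simp only [pnorm_mul, mul_pow, pnorm_uniformizer p F h0 h]
  · refine integrable_intHaar_prod p F ?_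
    have := continuous_pnorm p F (L := F)
    fun_prop
  · intro u hu
    rw [integral_congr_ae (g := fun _ => 1)]
    · simp
    · filter_upwards [ae_mem_integerRing p F] with v hv
      rw [pnorm_eq_one p F hu, one_pow, max_eq_left]
      have h2 := (pnorm_le_one_iff p F).mpr hv
      have h3 := pow_le_one₀ (n := 2) (pnorm_nonneg p F v) h2
      have h4 : 0 ≤ κ * t ^ 2 := by positivity
      nlinarith [sq_nonneg (pnorm p F v)]

/-- After the split, both arguments of the maximum carry the factor r²; with the mass r of ϖ𝒪_F this
gives r³. -/
theorem maxIntegral_div {κ t : ℝ} (hκ : 0 ≤ κ) (hκ1 : κ ≤ 1) (ht : 0 ≤ t) (ht1 : t ≤ 1) :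
    maxIntegral p F κ ((residueCard p F : ℝ)⁻¹ * t) = (1 - (residueCard p F : ℝ)⁻¹) +
      ((residueCard p F : ℝ)⁻¹) ^ 3 * maxIntegral p F κ t := by
  have hq := one_lt_residueCard p F
  have hq1 := inv_lt_one_of_one_lt₀ hq
  have hq0 : 0 < (residueCard p F : ℝ)⁻¹ := by positivity
  set r := (residueCard p F : ℝ)⁻¹ with hr
  rw [maxIntegral_split p F hκ, maxIntegral, ← hr]
  · have h2 : ∫ w : F × F, max (r ^ 2 * pnorm p F w.1 ^ 2)
        (κ * (r * t) ^ 2 * pnorm p F w.2 ^ 2) ∂((intHaar p F).prod (intHaar p F)) =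
        r ^ 2 * maxIntegral p F κ t := by
      rw [maxIntegral, ← integral_const_mul]
      congr 1
      ext w
      rw [mul_max_of_nonneg _ _ (sq_nonneg r)]
      ring_nf
    rw [h2, maxIntegral]
    ring
  · have h1 : (r * t) ^ 2 ≤ 1 := pow_le_one₀ (by positivity) (by nlinarith)
    nlinarith [sq_nonneg (r * t)]

theorem maxIntegral_one_one : maxIntegral p F 1 1 =
    (residueCard p F : ℝ) ^ 2 / ((residueCard p F : ℝ) ^ 2 + 1) := by
  have hq := one_lt_residueCard p F
  have hr1 := inv_lt_one_of_one_lt₀ hq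
  have h := maxIntegral_split p F (κ := 1) (t := 1) (by positivity) (by norm_num)
  set r := (residueCard p F : ℝ)⁻¹ with hr
  have hr0 : 0 < r := by positivity
  -- Splitting the two variables in turn returns to the start. With M(κ) the integral at t = 1, M(1)
  -- = (1 - r) + r M(r²) and M(r²) = (1 - r) + r³ M(1), so M(1) = 1/(1 + r²).
  have h' := maxIntegral_split p F (κ := r ^ 2) (t := 1) (by positivity) (by nlinarith)
  have h2 : ∫ w : F × F, max (r ^ 2 * pnorm p F w.1 ^ 2)
      (1 * 1 ^ 2 * pnorm p F w.2 ^ 2) ∂((intHaar p F).prod (intHaar p F)) =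
      maxIntegral p F (r ^ 2) 1 := by
    rw [← integral_prod_swap, maxIntegral]
    congr 1
    ext w
    rw [max_comm, Prod.fst_swap, Prod.snd_swap]
    ring_nf
  have h3 : ∫ w : F × F, max (r ^ 2 * pnorm p F w.1 ^ 2)
      (r ^ 2 * 1 ^ 2 * pnorm p F w.2 ^ 2) ∂((intHaar p F).prod (intHaar p F)) =
      r ^ 2 * maxIntegral p F 1 1 := by
    rw [maxIntegral, ← integral_const_mul]
    congr 1
    ext w
    rw [mul_max_of_nonneg _ _ (sq_nonneg r)]
    ring_nf
  rw [← hr, h3] at h'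
  rw [h2, h'] at h
  have h4 : r * residueCard p F = 1 := inv_mul_cancel₀ (by positivity)
  rw [eq_div_iff (by positivity)]
  have h5 : maxIntegral p F 1 1 * (1 + r ^ 2) = 1 :=
    mul_left_cancel₀ (a := 1 - r ^ 2) (by nlinarith) (by linear_combination h)
  linear_combination (residueCard p F : ℝ) ^ 2 * h5 -
    maxIntegral p F 1 1 * (r * residueCard p F + 1) * h4

theorem maxIntegral_inv_one : maxIntegral p F (residueCard p F : ℝ)⁻¹ 1 =
    (residueCard p F : ℝ) / ((residueCard p F : ℝ) + 1) := by
  have hq := one_lt_residueCard p F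
  have hr1 := inv_lt_one_of_one_lt₀ hq
  have h := maxIntegral_split p F (κ := (residueCard p F : ℝ)⁻¹) (t := 1) (by positivity)
    (by simpa using hr1.le)
  set r := (residueCard p F : ℝ)⁻¹ with hr
  have hr0 : 0 < r := by positivity
  -- Here one split suffices: taking out a factor r and exchanging the variables gives back the same
  -- integral, so M = (1 - r) + r²M.
  have h2 : ∫ w : F × F, max (r ^ 2 * pnorm p F w.1 ^ 2)
      (r * 1 ^ 2 * pnorm p F w.2 ^ 2) ∂((intHaar p F).prod (intHaar p F)) =
      r * maxIntegral p F r 1 := by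
    rw [← integral_prod_swap, maxIntegral, ← integral_const_mul]
    congr 1
    ext w
    rw [mul_max_of_nonneg _ _ hr0.le, max_comm, Prod.fst_swap, Prod.snd_swap]
    ring_nf
  rw [h2] at h
  have h3 : r * residueCard p F = 1 := inv_mul_cancel₀ (by positivity)
  rw [eq_div_iff (by positivity)]
  have h4 : maxIntegral p F r 1 * (1 + r) = 1 :=
    mul_left_cancel₀ (a := 1 - r) (by linarith) (by linear_combination h)
  linear_combination (residueCard p F : ℝ) * h4 - maxIntegral p F r 1 * h3

/-- By Fubini, from a continuous function on the compact 𝒪_F³; no regularity of `maxIntegral` in t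
is needed. -/
theorem integrable_pnorm_mul_maxIntegral (κ : ℝ) :
    Integrable (fun b : F => pnorm p F b * maxIntegral p F κ (pnorm p F b)) (intHaar p F) := by
  have hN := continuous_pnorm p F (L := F)
  have h : Integrable (fun x : F × F × F => pnorm p F x.1 *
      max (pnorm p F x.2.1 ^ 2) (κ * pnorm p F x.1 ^ 2 * pnorm p F x.2.2 ^ 2)) _ :=
    integrable_intHaar_prod_prod p F (by fun_prop)
  simpa only [integral_const_mul, maxIntegral] using h.integral_prod_left

theorem integral_pnorm_uniformizer_mul_maxIntegral {κ : ℝ} (hκ : 0 ≤ κ) (hκ1 : κ ≤ 1) {ϖ : F}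
    (h0 : ϖ ≠ 0) (h : ∀ x : F, ‖x‖ < 1 ↔ ‖x‖ ≤ ‖ϖ‖) {r : ℝ} (hr : r = (residueCard p F : ℝ)⁻¹) :
    ∫ b : F, pnorm p F (ϖ * b) * maxIntegral p F κ (pnorm p F (ϖ * b)) ∂(intHaar p F) =
      r * (1 - r) / (1 + r) + r ^ 4 *
        ∫ b : F, pnorm p F b * maxIntegral p F κ (pnorm p F b) ∂(intHaar p F) := by
  have hq := one_lt_residueCard p F
  have hr1 := inv_lt_one_of_one_lt₀ hq
  have hr0 : 0 < (residueCard p F : ℝ)⁻¹ := by positivity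
  have h1 := integral_pnorm_pow p F 1
  simp only [pow_one] at h1
  rw [← hr] at hr1 hr0 h1
  have h2 : ∀ᵐ b ∂(intHaar p F), pnorm p F (ϖ * b) * maxIntegral p F κ (pnorm p F (ϖ * b)) =
      r * (1 - r) * pnorm p F b +
        r ^ 4 * (pnorm p F b * maxIntegral p F κ (pnorm p F b)) := by
    filter_upwards [ae_mem_integerRing p F] with b hb
    rw [pnorm_mul, pnorm_uniformizer p F h0 h, maxIntegral_div p F hκ hκ1 (pnorm_nonneg p F b)
      ((pnorm_le_one_iff p F).mpr hb), ← hr]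
    ring
  rw [integral_congr_ae h2, integral_add, integral_const_mul, integral_const_mul, h1]
  · have h3 : 1 - r ≠ 0 := by linarith
    have h4 : 1 - r ^ (1 + 1) ≠ 0 :=
      (sub_pos.mpr (pow_lt_one₀ hr0.le hr1 (by lia))).ne'
    congr 1
    field_simp
    ring
  · exact (integrable_intHaar p F (continuous_pnorm p F)).const_mul _
  · exact (integrable_pnorm_mul_maxIntegral p F κ).const_mul _

theorem integral_pnorm_mul_maxIntegral {κ : ℝ} (hκ : 0 ≤ κ) (hκ1 : κ ≤ 1)
    {r : ℝ} (hr : r = (residueCard p F : ℝ)⁻¹) :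
    ∫ b : F, pnorm p F b * maxIntegral p F κ (pnorm p F b) ∂(intHaar p F) =
      ((1 - r) * maxIntegral p F κ 1 + r ^ 2 * (1 - r) / (1 + r)) / (1 - r ^ 5) := by
  obtain ⟨ϖ, h0, h1, h⟩ := exists_uniformizer p F
  have hq := one_lt_residueCard p F
  have hr1 := inv_lt_one_of_one_lt₀ hq
  have hr0 : 0 < (residueCard p F : ℝ)⁻¹ := by positivity
  have h2 := integral_intHaar_eq p F h0 h (integrable_pnorm_mul_maxIntegral p F κ)
    (c := maxIntegral p F κ 1) (fun x hx => by rw [pnorm_eq_one p F hx, one_mul])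
  rw [integral_pnorm_uniformizer_mul_maxIntegral p F hκ hκ1 h0 h hr, ← hr] at h2
  rw [← hr] at hr1 hr0
  have h5 : r ^ 5 < 1 := pow_lt_one₀ hr0.le hr1 (by lia)
  rw [eq_div_iff (by linarith)]
  linear_combination h2

end Uniformizer

end OneField

/-! ### Orthogonal integral bases of a quadratic extension -/

section Extension

variable (p : ℕ) [Fact p.Prime]
  (F : Type*) [NormedField F] [NormedAlgebra ℚ_[p] F] [FiniteDimensional ℚ_[p] F]
  (K : Type*) [NormedField K] [NormedAlgebra ℚ_[p] K] [FiniteDimensional ℚ_[p] K]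
  [Algebra F K] [IsScalarTower ℚ_[p] F K]

theorem pnorm_algebraMap (a : F) : pnorm p F (algebraMap F K a) = pnorm p F a := by
  rw [pnorm, norm_algebraMap_of_padic p F K, pnorm]

variable {K} in
/-- The basis `1, θ` of `K` over `F` is integral and orthogonal for the norm, and the square of the
normalized norm of `θ` is `κ`. -/
structure IsOrthogonalBasis (θ : K) (κ : ℝ) : Prop where
  pos : 0 < κ
  le_one : κ ≤ 1
  pnorm_sq (u v : F) : pnorm p F (algebraMap F K u + algebraMap F K v * θ) ^ 2 =
    max (pnorm p F u ^ 2) (κ * pnorm p F v ^ 2)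
  norm_le_one_iff (u v : F) : ‖algebraMap F K u + algebraMap F K v * θ‖ ≤ 1 ↔ ‖u‖ ≤ 1 ∧ ‖v‖ ≤ 1

variable {K}

include p in
theorem norm_add_mul_eq_max_of_residue {θ : K}
    (hθ : ∀ a : F, ‖a‖ ≤ 1 → ‖θ - algebraMap F K a‖ = 1) (u v : F) :
    ‖algebraMap F K u + algebraMap F K v * θ‖ = max ‖u‖ ‖v‖ := by
  have h1 : ‖θ‖ = 1 := by simpa using hθ 0 (by simp)
  rcases lt_or_ge ‖v‖ ‖u‖ with h | h
  · rw [norm_add_eq_of_lt p, norm_algebraMap_of_padic p F K, max_eq_left h.le]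
    rwa [norm_mul, h1, mul_one, norm_algebraMap_of_padic p F K, norm_algebraMap_of_padic p F K]
  · rw [max_eq_right h]
    by_cases hv : v = 0
    · subst hv
      have : u = 0 := by simpa using h
      simp [this]
    · have h2 : algebraMap F K u + algebraMap F K v * θ =
          algebraMap F K v * (θ - algebraMap F K (-u / v)) := by
        have : algebraMap F K v ≠ 0 := by simpa using hv
        rw [map_div₀, map_neg]
        field_simp
        ring
      have h3 : ‖-u / v‖ ≤ 1 := by
        rw [norm_div, norm_neg]
        exact div_le_one_of_le₀ h (norm_nonneg _)
      rw [h2, norm_mul, hθ _ h3, mul_one, norm_algebraMap_of_padic p F K]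

theorem isOrthogonalBasis_of_residue {θ : K}
    (hθ : ∀ a : F, ‖a‖ ≤ 1 → ‖θ - algebraMap F K a‖ = 1) : IsOrthogonalBasis p F θ 1 where
  pos := zero_lt_one
  le_one := le_rfl
  pnorm_sq u v := by
    rw [pnorm, norm_add_mul_eq_max_of_residue p F hθ, one_mul, pnorm, pnorm]
    rcases le_total ‖u‖ ‖v‖ with h | h
    · rw [max_eq_right h, max_eq_right (by gcongr)]
    · rw [max_eq_left h, max_eq_left (by gcongr)]
  norm_le_one_iff u v := by rw [norm_add_mul_eq_max_of_residue p F hθ, max_le_iff]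

-- The two terms have different norms unless both vanish: the square root of ‖ϖ‖ is not a norm of
-- `F`, as no norm of `F` lies strictly between ‖ϖ‖ and 1.
include p in
theorem norm_add_mul_eq_max_of_sq {θ : K} {ϖ : F} (h0 : ϖ ≠ 0) (h1 : ‖ϖ‖ < 1)
    (h : ∀ x : F, ‖x‖ < 1 ↔ ‖x‖ ≤ ‖ϖ‖) (hθ : ‖θ‖ ^ 2 = ‖ϖ‖) (u v : F) :
    ‖algebraMap F K u + algebraMap F K v * θ‖ = max ‖u‖ (‖v‖ * ‖θ‖) := by
  have hϖ := norm_pos_iff.mpr h0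
  rcases lt_trichotomy (‖v‖ * ‖θ‖) ‖u‖ with hlt | heq | hlt
  · rw [norm_add_eq_of_lt p, norm_algebraMap_of_padic p F K, max_eq_left hlt.le]
    rwa [norm_mul, norm_algebraMap_of_padic p F K, norm_algebraMap_of_padic p F K]
  · have hv : v = 0 := by
      by_contra hv
      have hv' := norm_pos_iff.mpr hv
      have h2 : ‖u / v‖ ^ 2 = ‖ϖ‖ := by
        rw [norm_div, ← heq, mul_div_cancel_left₀ _ hv'.ne', hθ]
      have h3 : ‖u / v‖ < 1 := by
        by_contra hge
        have := one_le_pow₀ (n := 2) (not_lt.mp hge)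
        linarith
      have h4 := (h _).mp h3
      nlinarith [norm_nonneg (u / v)]
    subst hv
    have hu : u = 0 := by simpa [eq_comm] using heq
    simp [hu]
  · rw [add_comm, norm_add_eq_of_lt p, norm_mul, norm_algebraMap_of_padic p F K,
      max_eq_right hlt.le]
    rwa [norm_mul, norm_algebraMap_of_padic p F K, norm_algebraMap_of_padic p F K]

theorem isOrthogonalBasis_of_sq {θ : K} {ϖ : F} (h0 : ϖ ≠ 0) (h1 : ‖ϖ‖ < 1)
    (h : ∀ x : F, ‖x‖ < 1 ↔ ‖x‖ ≤ ‖ϖ‖) (hθ : ‖θ‖ ^ 2 = ‖ϖ‖) :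
    IsOrthogonalBasis p F θ (pnorm p F ϖ) where
  pos := (pnorm_pos_iff p F).mpr h0
  le_one := (pnorm_le_one_iff p F).mpr h1.le
  pnorm_sq u v := by
    rw [pnorm, norm_add_mul_eq_max_of_sq p F h0 h1 h hθ, pnorm, pnorm, pnorm, ← hθ,
      pow_right_comm ‖θ‖, ← mul_pow, ← mul_pow, mul_comm ‖θ‖]
    have hθ0 := norm_nonneg θ
    rcases le_total ‖u‖ (‖v‖ * ‖θ‖) with h | h
    · rw [max_eq_right h, max_eq_right (by gcongr)]
    · rw [max_eq_left h, max_eq_left (by gcongr)]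
  norm_le_one_iff u v := by
    have hϖ := norm_pos_iff.mpr h0
    have hθ1 : ‖θ‖ < 1 := by
      by_contra hge
      have := one_le_pow₀ (n := 2) (not_lt.mp hge)
      linarith
    have hθ0 : 0 < ‖θ‖ := by
      rcases (norm_nonneg θ).eq_or_lt with h2 | h2
      · rw [← h2] at hθ; simp at hθ; linarith
      · exact h2
    rw [norm_add_mul_eq_max_of_sq p F h0 h1 h hθ, max_le_iff]
    refine and_congr_right fun _ => ⟨fun hv => ?_, fun hv => ?_⟩
    -- If ‖v‖ > 1, then ‖v⁻¹‖ ≤ ‖ϖ‖ = ‖θ‖² < ‖θ‖, whereas ‖v‖‖θ‖ ≤ 1 says ‖θ‖ ≤ ‖v⁻¹‖.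
    · by_contra hv1
      rw [not_le] at hv1
      have h2 : ‖v⁻¹‖ ≤ ‖ϖ‖ := by rw [← h, norm_inv]; exact inv_lt_one_of_one_lt₀ hv1
      have h3 : ‖θ‖ ≤ ‖v⁻¹‖ := by
        rw [norm_inv, ← one_div, le_div_iff₀ (by linarith), mul_comm]; exact hv
      nlinarith
    · nlinarith [norm_nonneg v]

theorem residueCard_eq_of_residue
    (hres : ∀ x : K, ‖x‖ ≤ 1 → ∃ a : F, ‖a‖ ≤ 1 ∧ ‖x - algebraMap F K a‖ < 1) :
    residueCard p F = residueCard p K := by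
  let φ : integerRing p F →+* integerRing p K :=
    ((algebraMap F K).comp (integerRing p F).subtype).codRestrict (integerRing p K)
      fun a => (norm_algebraMap_of_padic p F K a).trans_le a.2
  refine residueCard_eq_of_surjective p F
    ((IsLocalRing.residue (integerRing p K)).comp φ) fun y => ?_
  obtain ⟨x, rfl⟩ := IsLocalRing.residue_surjective y
  obtain ⟨a, ha, hxa⟩ := hres x x.2
  refine ⟨⟨a, ha⟩, ?_⟩
  rw [RingHom.comp_apply, eq_comm, ← sub_eq_zero, ← map_sub, IsLocalRing.residue_eq_zero_iff,
    mem_maximalIdeal_integerRing]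
  exact hxa

include p in
theorem residue_dichotomy : (∃ θ : K, ∀ a : F, ‖a‖ ≤ 1 → ‖θ - algebraMap F K a‖ = 1) ∨
    ∀ x : K, ‖x‖ ≤ 1 → ∃ a : F, ‖a‖ ≤ 1 ∧ ‖x - algebraMap F K a‖ < 1 := by
  by_contra! hcon
  obtain ⟨h1, x, hx, h2⟩ := hcon
  obtain ⟨a, ha, h3⟩ := h1 x
  refine h3 (le_antisymm ?_ (h2 a ha))
  rw [sub_eq_add_neg]
  refine (norm_add_le_max_of_padic p K x _).trans (max_le hx ?_)
  rw [norm_neg, norm_algebraMap_of_padic p F K]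
  exact ha

variable [MeasurableSpace F] [BorelSpace F] [MeasurableSpace K] [BorelSpace K]

-- With equal residue fields, the modulus of a uniformizer is 1/q in both fields. In `K` the
-- exponent of the norm is twice that in `F`, so a uniformizer of `K` will do.
include p in
theorem exists_norm_sq_eq (hK : finrank F K = 2) {ϖ : F} (h0 : ϖ ≠ 0)
    (h : ∀ x : F, ‖x‖ < 1 ↔ ‖x‖ ≤ ‖ϖ‖)
    (hres : ∀ x : K, ‖x‖ ≤ 1 → ∃ a : F, ‖a‖ ≤ 1 ∧ ‖x - algebraMap F K a‖ < 1) :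
    ∃ θ : K, ‖θ‖ ^ 2 = ‖ϖ‖ := by
  obtain ⟨θ, hθ0, -, hθ⟩ := exists_uniformizer p K
  have h1 := residueCard_mul_norm_pow p F h0 h
  have h2 := residueCard_mul_norm_pow p K hθ0 hθ
  have := FiniteDimensional.right ℚ_[p] F K
  rw [← residueCard_eq_of_residue p F hres, ← finrank_mul_finrank ℚ_[p] F K, hK, mul_comm _ 2,
    pow_mul] at h2
  refine ⟨θ, (pow_left_inj₀ (by positivity) (norm_nonneg _) (finrank_padic_ne_zero p F)).mp ?_⟩
  have hq : (residueCard p F : ℝ) ≠ 0 := by exact_mod_cast residueCard_ne_zero p F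
  exact mul_left_cancel₀ hq (h2.trans h1.symm)

end Extension

/-! ### Ramification and the integral basis of 𝒪_K -/

section Extension

variable (p : ℕ) [Fact p.Prime]
  (F : Type*) [NormedField F] [NormedAlgebra ℚ_[p] F] [FiniteDimensional ℚ_[p] F]
  (K : Type*) [NormedField K] [NormedAlgebra ℚ_[p] K] [FiniteDimensional ℚ_[p] K]
  [Algebra F K] [IsScalarTower ℚ_[p] F K]

theorem isDedekindDomain_integers : IsDedekindDomain (integers p F K) := by
  have := charZero_of_padic p F
  have := FiniteDimensional.right ℚ_[p] F K
  exact integralClosure.isDedekindDomain (integerRing p F) F K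

/-- Both ramification hypotheses quantify over all maximal ideals; this explicit one is where they
are tested. -/
theorem exists_isMaximal_integers : ∃ P : Ideal (integers p F K), P.IsMaximal ∧
    ∀ x, x ∈ P ↔ ‖(x : K)‖ < 1 := by
  let φ : integers p F K →+* integerRing p K :=
    { toFun := fun x => ⟨x, (mem_integers p F K).mp x.2⟩
      map_one' := rfl
      map_mul' := fun _ _ => rfl
      map_zero' := rfl
      map_add' := fun _ _ => rfl }
  have hφ : Function.Surjective φ := fun x => ⟨⟨x, (mem_integers p F K).mpr x.2⟩, rfl⟩
  refine ⟨RingHom.ker ((IsLocalRing.residue (integerRing p K)).comp φ),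
    RingHom.ker_isMaximal_of_surjective _ (IsLocalRing.residue_surjective.comp hφ), fun x => ?_⟩
  rw [RingHom.mem_ker, RingHom.comp_apply, IsLocalRing.residue_eq_zero_iff,
    mem_maximalIdeal_integerRing]
  rfl

theorem norm_algebraMap_integers (a : integerRing p F) :
    ‖((algebraMap (integerRing p F) (integers p F K) a : integers p F K) : K)‖ = ‖(a : F)‖ :=
  norm_algebraMap_of_padic p F K a

omit [FiniteDimensional ℚ_[p] F] [NormedAlgebra ℚ_[p] K] [FiniteDimensional ℚ_[p] K]
  [IsScalarTower ℚ_[p] F K] in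
theorem isTorsionFree_integers : Module.IsTorsionFree (integerRing p F) (integers p F K) := by
  have := (integerRing p F).toSubring.instIsDomainSubtypeMem
  rw [Module.isTorsionFree_iff_algebraMap_injective]
  intro a b hab
  have h : algebraMap F K a = algebraMap F K b := congrArg Subtype.val hab
  exact Subtype.ext ((algebraMap F K).injective h)

/-- The ramification index is not `1` if and only if a uniformizer of `F` lies in the square of the
maximal ideal of `𝒪_K`. -/
theorem ramificationIdx_ne_one_iff {ϖ : F} (h0 : ϖ ≠ 0) (h1 : ‖ϖ‖ < 1)
    (h : ∀ x : F, ‖x‖ < 1 ↔ ‖x‖ ≤ ‖ϖ‖) {P : Ideal (integers p F K)} (hP : P.IsMaximal)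
    (hPmem : ∀ x, x ∈ P ↔ ‖(x : K)‖ < 1) : P.ramificationIdx (integerRing p F) ≠ 1 ↔
      algebraMap (integerRing p F) (integers p F K) ⟨ϖ, h1.le⟩ ∈ P ^ 2 := by
  have := isDedekindDomain_integers p F K
  have := isTorsionFree_integers p F K
  let 𝔭 := IsLocalRing.maximalIdeal (integerRing p F)
  have hspan : 𝔭 = Ideal.span {(⟨ϖ, h1.le⟩ : integerRing p F)} := by
    ext x
    rw [mem_maximalIdeal_integerRing, h, Ideal.mem_span_singleton']
    constructor
    · intro hx
      refine ⟨⟨x / ϖ, ?_⟩, ?_⟩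
      · rw [mem_integerRing, norm_div]
        exact div_le_one_of_le₀ hx (norm_nonneg _)
      · ext
        exact div_mul_cancel₀ _ h0
    · rintro ⟨a, rfl⟩
      change ‖(a : F) * ϖ‖ ≤ ‖ϖ‖
      rw [norm_mul]
      exact mul_le_of_le_one_left (norm_nonneg _) a.2
  have hover : P.LiesOver 𝔭 := ⟨by
    ext x
    rw [mem_maximalIdeal_integerRing, Ideal.mem_comap, hPmem, norm_algebraMap_integers]⟩
  have hne : 𝔭 ≠ ⊥ := by
    rw [hspan, Ne, Ideal.span_singleton_eq_bot]
    exact fun h2 => h0 (congrArg Subtype.val h2)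
  have := hP.isPrime
  have hle : 𝔭.map (algebraMap (integerRing p F) (integers p F K)) ≤ P :=
    Ideal.map_le_iff_le_comap.mpr hover.over.le
  rw [← Ideal.ramificationIdx'_eq_ramificationIdx 𝔭 P hne, Ideal.ramificationIdx'_ne_one_iff hle,
    hspan, Ideal.map_span, Set.image_singleton, Ideal.span_singleton_le_iff_mem]

variable {K}

theorem not_isUnramified_of_sq {θ : K} {ϖ : F} (h0 : ϖ ≠ 0) (h1 : ‖ϖ‖ < 1)
    (h : ∀ x : F, ‖x‖ < 1 ↔ ‖x‖ ≤ ‖ϖ‖) (hθ : ‖θ‖ ^ 2 = ‖ϖ‖) : ¬ IsUnramified p F K := by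
  obtain ⟨P, hP, hPmem⟩ := exists_isMaximal_integers p F K
  intro hunr
  refine (ramificationIdx_ne_one_iff p F K h0 h1 h hP hPmem).mpr ?_ (hunr P hP)
  have hθ1 : ‖θ‖ < 1 := by
    by_contra hge
    have := one_le_pow₀ (n := 2) (not_lt.mp hge)
    linarith
  have hθ0 : θ ≠ 0 := by
    rintro rfl
    simp at hθ
    exact h0 (norm_eq_zero.mp hθ.symm)
  let t : integers p F K := ⟨θ, (mem_integers p F K).mpr hθ1.le⟩
  -- The quotient has norm 1, so ϖ is an integral multiple of θ², with θ in the maximal ideal.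
  let u : integers p F K := ⟨algebraMap F K ϖ / θ ^ 2, by
    rw [mem_integers, norm_div, norm_pow, hθ, norm_algebraMap_of_padic p F K]
    exact div_self_le_one _⟩
  have : algebraMap (integerRing p F) (integers p F K) ⟨ϖ, h1.le⟩ = u * t ^ 2 := by
    ext
    change algebraMap F K ϖ = algebraMap F K ϖ / θ ^ 2 * θ ^ 2
    rw [div_mul_cancel₀ _ (pow_ne_zero 2 hθ0)]
  rw [this]
  exact Ideal.mul_mem_left _ _ (Ideal.pow_mem_pow ((hPmem t).mpr hθ1) 2)

theorem not_isTotallyRamified_of_norm_mem_range (hK : finrank F K = 2)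
    (hnorm : ∀ x : K, ∃ a : F, ‖x‖ = ‖a‖) : ¬ IsTotallyRamified p F K := by
  obtain ⟨ϖ, h0, h1, h⟩ := exists_uniformizer p F
  obtain ⟨P, hP, hPmem⟩ := exists_isMaximal_integers p F K
  intro hram
  have h2 : P.ramificationIdx (integerRing p F) ≠ 1 := by
    rw [hram P hP, hK]; norm_num
  rw [ramificationIdx_ne_one_iff p F K h0 h1 h hP hPmem, pow_two] at h2
  -- Since norms of `K` are norms of `F`, elements of `P` have norm at most ‖ϖ‖ and elements of its
  -- square at most ‖ϖ‖², which excludes ϖ.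
  have hle (x : integers p F K) (hx : x ∈ P) : ‖(x : K)‖ ≤ ‖ϖ‖ := by
    obtain ⟨a, ha⟩ := hnorm x
    rw [ha, ← h, ← ha]
    exact (hPmem x).mp hx
  have h3 : ‖((algebraMap (integerRing p F) (integers p F K) ⟨ϖ, h1.le⟩ : integers p F K) : K)‖ ≤
      ‖ϖ‖ * ‖ϖ‖ := by
    refine Submodule.mul_induction_on h2 (fun a ha b hb => ?_) fun a b ha hb => ?_
    · rw [MulMemClass.coe_mul, norm_mul]
      exact mul_le_mul (hle a ha) (hle b hb) (norm_nonneg _) (norm_nonneg _)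
    · exact (norm_add_le_max_of_padic p K a b).trans (max_le ha hb)
  rw [norm_algebraMap_integers] at h3
  nlinarith [norm_pos_iff.mpr h0]

variable {F}

omit [NormedAlgebra ℚ_[p] K] [FiniteDimensional ℚ_[p] K] [IsScalarTower ℚ_[p] F K] in
theorem IsOrthogonalBasis.coeff_eq_zero {θ : K} {κ : ℝ} (hθ : IsOrthogonalBasis p F θ κ) {u v : F}
    (h : algebraMap F K u + algebraMap F K v * θ = 0) : u = 0 ∧ v = 0 := by
  have h1 := hθ.pnorm_sq u v
  rw [h, (pnorm_eq_zero_iff p F).mpr rfl, zero_pow two_ne_zero] at h1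
  have h2 : pnorm p F u ^ 2 ≤ 0 := (le_max_left _ _).trans h1.ge
  have h3 : κ * pnorm p F v ^ 2 ≤ 0 := (le_max_right _ _).trans h1.ge
  have hκ := hθ.pos
  constructor
  · rw [← pnorm_eq_zero_iff p F]
    exact pow_eq_zero_iff two_ne_zero |>.mp (le_antisymm h2 (sq_nonneg _))
  · rw [← pnorm_eq_zero_iff p F]
    refine pow_eq_zero_iff two_ne_zero |>.mp (le_antisymm ?_ (sq_nonneg _))
    by_contra hcon
    have := mul_pos hκ (not_le.mp hcon)
    linarith

theorem IsOrthogonalBasis.exists_eq {θ : K} {κ : ℝ} (hθ : IsOrthogonalBasis p F θ κ)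
    (hK : finrank F K = 2) (x : K) : ∃ u v : F, algebraMap F K u + algebraMap F K v * θ = x := by
  have hfin := FiniteDimensional.right ℚ_[p] F K
  have hli : LinearIndependent F ![(1 : K), θ] := by
    rw [LinearIndependent.pair_iff]
    intro s t hst
    rw [Algebra.smul_def, Algebra.smul_def, mul_one] at hst
    exact hθ.coeff_eq_zero p hst
  have hspan := hli.span_eq_top_of_card_eq_finrank (by simp [hK])
  have hx : x ∈ Submodule.span F (Set.range ![(1 : K), θ]) := by rw [hspan]; trivial
  rw [Matrix.range_cons, Matrix.range_cons, Matrix.range_empty, Set.union_empty,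
    Set.singleton_union, Submodule.mem_span_pair] at hx
  obtain ⟨u, v, huv⟩ := hx
  exact ⟨u, v, by rw [← huv, Algebra.smul_def, Algebra.smul_def, mul_one]⟩

theorem IsOrthogonalBasis.mem_integers {θ : K} {κ : ℝ} (hθ : IsOrthogonalBasis p F θ κ) :
    θ ∈ integers p F K := by
  rw [PadicRoots.mem_integers]
  have := (hθ.norm_le_one_iff 0 1).mpr ⟨by simp, by simp⟩
  simpa using this

theorem IsOrthogonalBasis.exists_basis {θ : K} {κ : ℝ} (hθ : IsOrthogonalBasis p F θ κ)
    (hK : finrank F K = 2) : ∃ b : Basis (Fin 2) (integerRing p F) (integers p F K),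
      b 0 = 1 ∧ b 1 = ⟨θ, hθ.mem_integers p⟩ := by
  have hli : LinearIndependent (integerRing p F)
      ![(1 : integers p F K), ⟨θ, hθ.mem_integers p⟩] := by
    rw [LinearIndependent.pair_iff]
    intro s t hst
    have h1 : algebraMap F K s + algebraMap F K t * θ = 0 := by
      have := congrArg Subtype.val hst
      rw [Algebra.smul_def, Algebra.smul_def, mul_one] at this
      exact this
    obtain ⟨hs, ht⟩ := hθ.coeff_eq_zero p h1
    exact ⟨Subtype.ext hs, Subtype.ext ht⟩
  have hspan : ⊤ ≤ Submodule.span (integerRing p F)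
      (Set.range ![(1 : integers p F K), ⟨θ, hθ.mem_integers p⟩]) := by
    rintro x -
    rw [Matrix.range_cons, Matrix.range_cons, Matrix.range_empty, Set.union_empty,
      Set.singleton_union, Submodule.mem_span_pair]
    obtain ⟨u, v, huv⟩ := hθ.exists_eq p hK x
    have hx := (PadicRoots.mem_integers p F K).mp x.2
    rw [← huv, hθ.norm_le_one_iff] at hx
    refine ⟨⟨u, hx.1⟩, ⟨v, hx.2⟩, ?_⟩
    ext
    rw [Algebra.smul_def, Algebra.smul_def, mul_one]
    exact huv
  exact ⟨Basis.mk hli hspan, by simp, by simp⟩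

end Extension

/-! ### The discriminant -/

/-- The change-of-basis determinant is a unit. This allows the basis chosen in `discriminant` to be
replaced by 1, θ. -/
theorem exists_discr_eq_sq_mul {A B ι κ : Type*} [CommRing A] [CommRing B] [Algebra A B]
    [Fintype ι] [DecidableEq ι] [Fintype κ] [DecidableEq κ] [StrongRankCondition A]
    (b : Basis ι A B) (c : Basis κ A B) :
    ∃ u : A, IsUnit u ∧ Algebra.discr A b = u ^ 2 * Algebra.discr A c := by
  let e : κ ≃ ι := c.indexEquiv b
  refine ⟨((c.reindex e).toMatrix b).det, ?_, ?_⟩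
  · rw [← LinearMap.toMatrix_id_eq_basis_toMatrix b (c.reindex e)]
    exact LinearEquiv.isUnit_det (LinearEquiv.refl A B) b (c.reindex e)
  · have h := Algebra.discr_of_matrix_vecMul (c.reindex e) ((c.reindex e).toMatrix b)
    rw [Basis.toMatrix_map_vecMul] at h
    rw [h, Basis.coe_reindex, Algebra.discr_reindex]

/-- The discriminant of `A[θ]` for `θ ^ 2 = t θ - n`. -/
theorem discr_quadratic {A B : Type*} [CommRing A] [CommRing B] [Algebra A B]
    (b : Basis (Fin 2) A B) (h0 : b 0 = 1) (t n : A) (h : b 1 * b 1 = t • b 1 - n • b 0) :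
    Algebra.discr A b = t ^ 2 - 4 * n := by
  have htr1 (a : A) : Algebra.trace A B (a • b 0) = 2 * a := by
    rw [h0, ← Algebra.algebraMap_eq_smul_one, Algebra.trace_algebraMap_of_basis b]
    simp
  have htrθ : Algebra.trace A B (b 1) = t := by
    rw [Algebra.trace_eq_matrix_trace b, Matrix.trace, Fin.sum_univ_two, Matrix.diag_apply,
      Matrix.diag_apply, Algebra.leftMulMatrix_eq_repr_mul, Algebra.leftMulMatrix_eq_repr_mul, h,
      h0, mul_one]
    simp [← h0]
  have h1 : Algebra.trace A B (b 0) = 2 := by simpa using htr1 1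
  rw [Algebra.discr_def, Matrix.det_fin_two]
  simp only [Algebra.traceMatrix_apply, Algebra.traceForm_apply]
  rw [h, map_sub, map_smul, htr1, htrθ]
  simp only [h0, one_mul, mul_one]
  rw [htrθ, ← h0, h1, smul_eq_mul]
  ring

/-- A quadratic polynomial of discriminant zero has a double root over a perfect field: t/2 in
general, and in characteristic 2, where t = 0, a square root of -n. -/
theorem exists_root_of_sq_eq_four_mul {k : Type*} [Field k] [Finite k] (t n : k)
    (h : t ^ 2 = 4 * n) : ∃ a : k, a ^ 2 - t * a + n = 0 := by
  by_cases h2 : (2 : k) = 0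
  · have ht : t = 0 := by
      have : t ^ 2 = 0 := by rw [h]; linear_combination 2 * n * h2
      exact pow_eq_zero_iff two_ne_zero |>.mp this
    have : CharP k 2 := CharTwo.of_one_ne_zero_of_two_eq_zero one_ne_zero h2
    obtain ⟨a, ha⟩ := FiniteField.isSquare_of_char_two (F := k) (ringChar.eq k 2) (-n)
    exact ⟨a, by rw [ht]; linear_combination -ha⟩
  · refine ⟨t / 2, ?_⟩
    field_simp
    linear_combination -h

section Extension

variable (p : ℕ) [Fact p.Prime]
  {F : Type*} [NormedField F] [NormedAlgebra ℚ_[p] F] [FiniteDimensional ℚ_[p] F]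
  {K : Type*} [NormedField K] [NormedAlgebra ℚ_[p] K] [FiniteDimensional ℚ_[p] K]
  [Algebra F K] [IsScalarTower ℚ_[p] F K]

theorem finite_residueField [MeasurableSpace F] [BorelSpace F] :
    Finite (IsLocalRing.ResidueField (integerRing p F)) :=
  Nat.finite_of_card_ne_zero (residueCard_ne_zero p F)

omit [FiniteDimensional ℚ_[p] F] in
theorem norm_eq_one_of_isUnit {u : integerRing p F} (hu : IsUnit u) : ‖(u : F)‖ = 1 := by
  refine le_antisymm u.2 (not_lt.mp fun h => ?_)
  exact (IsLocalRing.mem_maximalIdeal u).mp ((mem_maximalIdeal_integerRing p F u).mpr h) hu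

/-- If t² - 4n were not a unit, X² - tX + n would have a root a modulo the maximal ideal; then (θ -
a)(θ - (t - a)) would have norm less than 1, although both factors have norm 1. -/
theorem pnorm_discriminant_eq_one [MeasurableSpace F] [BorelSpace F] (hK : finrank F K = 2) {θ : K}
    (hθ : ∀ a : F, ‖a‖ ≤ 1 → ‖θ - algebraMap F K a‖ = 1) :
    pnorm p F (discriminant p F K : F) = 1 := by
  have hfin := finite_residueField p (F := F)
  obtain ⟨b, hb0, hb1⟩ := (isOrthogonalBasis_of_residue p F hθ).exists_basis p hK
  obtain ⟨u, hu, hdisc⟩ := exists_discr_eq_sq_mul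
    (Module.Free.chooseBasis (integerRing p F) (integers p F K)) b
  obtain ⟨t, n, htn⟩ : ∃ t n : integerRing p F, b 1 * b 1 = t • b 1 - n • b 0 := by
    refine ⟨b.repr (b 1 * b 1) 1, -b.repr (b 1 * b 1) 0, ?_⟩
    conv_lhs => rw [← b.sum_repr (b 1 * b 1)]
    rw [Fin.sum_univ_two, neg_smul, sub_neg_eq_add, add_comm]
  rw [discriminant, hdisc, discr_quadratic b hb0 t n htn, pnorm_eq_one]
  have hval : ((u ^ 2 * (t ^ 2 - 4 * n) : integerRing p F) : F) =
      (u : F) ^ 2 * ((t ^ 2 - 4 * n : integerRing p F) : F) := rfl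
  rw [hval, norm_mul, norm_pow, norm_eq_one_of_isUnit p hu, one_pow, one_mul]
  refine le_antisymm (t ^ 2 - 4 * n).2 (not_lt.mp fun hlt => ?_)
  rw [← mem_maximalIdeal_integerRing p F, ← IsLocalRing.residue_eq_zero_iff] at hlt
  obtain ⟨a', ha'⟩ := exists_root_of_sq_eq_four_mul (IsLocalRing.residue (integerRing p F) t)
    (IsLocalRing.residue (integerRing p F) n) (by
      rw [map_sub, map_mul, map_pow, map_ofNat, sub_eq_zero] at hlt
      exact hlt)
  obtain ⟨a, rfl⟩ := IsLocalRing.residue_surjective a'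
  rw [← map_pow, ← map_mul, ← map_sub, ← map_add, IsLocalRing.residue_eq_zero_iff,
    mem_maximalIdeal_integerRing] at ha'
  have hsq : θ * θ = algebraMap F K t * θ - algebraMap F K n := by
    have := congrArg Subtype.val htn
    rw [hb0, hb1, Algebra.smul_def, Algebra.smul_def, mul_one] at this
    exact this
  have hprod : (θ - algebraMap F K a) * (θ - algebraMap F K (t - a)) =
      -algebraMap F K (a ^ 2 - t * a + n) := by
    simp only [map_sub, map_add, map_mul, map_pow]
    linear_combination hsq
  have h1 := congrArg norm hprod
  rw [norm_mul, hθ a a.2, hθ (t - a) (t - a).2, norm_neg, norm_algebraMap_of_padic p F K] at h1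
  have h2 : ‖(a : F) ^ 2 - t * a + n‖ < 1 := ha'
  linarith

end Extension

/-! ### Values of random polynomials -/

section OneField

variable (p : ℕ) [Fact p.Prime]
  (F : Type*) [NormedField F] [NormedAlgebra ℚ_[p] F] [FiniteDimensional ℚ_[p] F]
  [MeasurableSpace F] [BorelSpace F]

theorem measurePreserving_add_right_intHaar {a : F} (ha : ‖a‖ ≤ 1) :
    MeasurePreserving (· + a) (intHaar p F) (intHaar p F) := by
  have h := (measurePreserving_add_right (haar p F) a).restrict_preimage
    (measurableSet_integerRing p F)
  have hpre : (· + a) ⁻¹' (integerRing p F : Set F) = integerRing p F := by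
    ext x
    exact ⟨fun hx => by simpa using sub_mem (H := integerRing p F) hx ha,
      fun hx => (integerRing p F).add_mem _ _ hx ha⟩
  rwa [hpre] at h

/-- The probability measure on `𝒪_F ^ m`. -/
abbrev piHaar (m : ℕ) : Measure (Fin m → F) := Measure.pi fun _ => intHaar p F

theorem ae_mem_integerRing_pi (m : ℕ) : ∀ᵐ c ∂(piHaar p F m), ∀ i, ‖c i‖ ≤ 1 := by
  rw [ae_all_iff]
  intro i
  exact (measurePreserving_eval (fun _ : Fin m => intHaar p F) i).quasiMeasurePreserving.ae
    (ae_mem_integerRing p F)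

omit [FiniteDimensional ℚ_[p] F] [MeasurableSpace F] [BorelSpace F] in
include p in
theorem norm_sum_mul_le_one {m : ℕ} {c a : Fin m → F} (hc : ∀ i, ‖c i‖ ≤ 1) (ha : ∀ i, ‖a i‖ ≤ 1) :
    ‖∑ i, c i * a i‖ ≤ 1 :=
  sum_mem (S := integerRing p F) (t := Finset.univ) (f := fun i => c i * a i)
    fun i _ => (integerRing p F).mul_mem _ _ (hc i) (ha i)

/-- Once the coefficients of index at least 2 are fixed, the first two are merely translated by
elements of 𝒪_F, which preserves their law. -/
theorem measurePreserving_affine {m : ℕ} (a b : Fin m → F) (ha : ∀ i, ‖a i‖ ≤ 1)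
    (hb : ∀ i, ‖b i‖ ≤ 1) :
    MeasurePreserving (fun c : Fin (m + 2) → F =>
        (c 0 + ∑ i : Fin m, c i.succ.succ * a i, c 1 + ∑ i : Fin m, c i.succ.succ * b i))
      (piHaar p F (m + 2)) ((intHaar p F).prod (intHaar p F)) := by
  have := properSpace_of_padic p F
  have h1 := measurePreserving_piFinSuccAbove (fun _ : Fin (m + 2) => intHaar p F) 0
  have h2 := (MeasurePreserving.id (intHaar p F)).prod
    (measurePreserving_piFinSuccAbove (fun _ : Fin (m + 1) => intHaar p F) 0)
  have h3 := (measurePreserving_prodAssoc (intHaar p F) (intHaar p F) (piHaar p F m)).symm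
  have h4 := Measure.measurePreserving_swap (μ := (intHaar p F).prod (intHaar p F))
    (ν := piHaar p F m)
  have h5 : MeasurePreserving (fun z : (Fin m → F) × (F × F) =>
      (z.1, (z.2.1 + ∑ i, z.1 i * a i, z.2.2 + ∑ i, z.1 i * b i)))
      ((piHaar p F m).prod ((intHaar p F).prod (intHaar p F)))
      ((piHaar p F m).prod ((intHaar p F).prod (intHaar p F))) := by
    refine (MeasurePreserving.id (piHaar p F m)).skew_product
      (g := fun c (w : F × F) => (w.1 + ∑ i, c i * a i, w.2 + ∑ i, c i * b i)) ?_ ?_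
    · exact Continuous.measurable (by unfold Function.uncurry; fun_prop)
    · filter_upwards [ae_mem_integerRing_pi p F m] with c hc
      exact ((measurePreserving_add_right_intHaar p F (norm_sum_mul_le_one p F hc ha)).prod
        (measurePreserving_add_right_intHaar p F (norm_sum_mul_le_one p F hc hb))).map_eq
  have h6 := measurePreserving_snd (μ := piHaar p F m) (ν := (intHaar p F).prod (intHaar p F))
  exact h6.comp (h5.comp (h4.comp (h3.comp (h2.comp h1))))

theorem measurePreserving_shear {a : F} (ha : ‖a‖ ≤ 1) :
    MeasurePreserving (fun w : F × F => (w.1 + w.2 * a, w.2))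
      ((intHaar p F).prod (intHaar p F)) ((intHaar p F).prod (intHaar p F)) := by
  have := properSpace_of_padic p F
  have h1 := Measure.measurePreserving_swap (μ := intHaar p F) (ν := intHaar p F)
  have h2 : MeasurePreserving (fun z : F × F => (z.1, z.2 + z.1 * a))
      ((intHaar p F).prod (intHaar p F)) ((intHaar p F).prod (intHaar p F)) := by
    refine (MeasurePreserving.id (intHaar p F)).skew_product (g := fun v u => u + v * a) ?_ ?_
    · exact Continuous.measurable (by unfold Function.uncurry; fun_prop)
    · filter_upwards [ae_mem_integerRing p F] with v hv
      exact (measurePreserving_add_right_intHaar p F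
        ((integerRing p F).mul_mem _ _ hv ha)).map_eq
  exact h1.comp (h2.comp h1)

end OneField

section Extension

variable (p : ℕ) [Fact p.Prime]
  {F : Type*} [NormedField F] [NormedAlgebra ℚ_[p] F] [FiniteDimensional ℚ_[p] F]
  {K : Type*} [NormedField K] [NormedAlgebra ℚ_[p] K] [FiniteDimensional ℚ_[p] K]
  [Algebra F K] [IsScalarTower ℚ_[p] F K]

omit [FiniteDimensional ℚ_[p] F] [NormedAlgebra ℚ_[p] K] [FiniteDimensional ℚ_[p] K]
  [IsScalarTower ℚ_[p] F K] in
theorem exists_pow_eq {x : K} {t n : integerRing p F}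
    (hx : x ^ 2 = algebraMap F K t * x - algebraMap F K n) (i : ℕ) :
    ∃ a b : integerRing p F, x ^ i = algebraMap F K a + algebraMap F K b * x := by
  induction i with
  | zero => exact ⟨1, 0, by simp⟩
  | succ i ih =>
    obtain ⟨a, b, h⟩ := ih
    refine ⟨-(b * n), a + b * t, ?_⟩
    have h1 : ((-(b * n) : integerRing p F) : F) = -((b : F) * n) := rfl
    have h2 : ((a + b * t : integerRing p F) : F) = (a : F) + b * t := rfl
    rw [pow_succ, h, h1, h2, map_neg, map_mul, map_add, map_mul]
    linear_combination algebraMap F K b * hx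

include p in
theorem continuous_algebraMap_of_padic : Continuous (algebraMap F K) :=
  AddMonoidHomClass.continuous_of_bound (algebraMap F K) 1
    fun a => by rw [norm_algebraMap_of_padic p F K, one_mul]

variable [MeasurableSpace F] [BorelSpace F]

/-- For a quadratic integer `x` and `m ≥ 1`, a random polynomial of degree at most `m` takes at
`x` a value which is uniformly distributed in `𝒪_F[x]`. -/
theorem polyIntegral_quadratic {x : K} {t n : integerRing p F}
    (hx : x ^ 2 = algebraMap F K t * x - algebraMap F K n) (m r : ℕ) :
    polyIntegral p F K (m + 1) r x = ∫ w : F × F,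
      pnorm p F (algebraMap F K w.1 + algebraMap F K w.2 * x) ^ r
        ∂((intHaar p F).prod (intHaar p F)) := by
  have := properSpace_of_padic p F
  choose a b hab using fun i => exists_pow_eq p hx i
  have hS := measurePreserving_affine p F (fun i : Fin m => (a (i + 2) : F))
    (fun i : Fin m => (b (i + 2) : F)) (fun i => (a (i + 2)).2) (fun i => (b (i + 2)).2)
  have hcont : Continuous fun w : F × F =>
      pnorm p F (algebraMap F K w.1 + algebraMap F K w.2 * x) ^ r := by
    have h1 := continuous_pnorm p F (L := K)
    have h2 := continuous_algebraMap_of_padic p (F := F) (K := K)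
    fun_prop
  rw [polyIntegral, ← hS.map_eq, integral_map hS.measurable.aemeasurable
    hcont.aestronglyMeasurable]
  refine integral_congr_ae (Filter.Eventually.of_forall fun c => ?_)
  simp only
  congr 2
  rw [Fin.sum_univ_succ, Fin.sum_univ_succ]
  simp only [Fin.val_zero, pow_zero, mul_one, Fin.succ_zero_eq_one, Fin.val_one, pow_one,
    Fin.val_succ, map_add, map_sum, map_mul, add_mul, Finset.sum_mul]
  have (i : Fin m) : algebraMap F K (c i.succ.succ) * x ^ ((i : ℕ) + 1 + 1) =
      algebraMap F K (c i.succ.succ) * algebraMap F K (a (i + 2)) +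
        algebraMap F K (c i.succ.succ) * algebraMap F K (b (i + 2)) * x := by
    rw [add_assoc, hab]; ring
  rw [Finset.sum_congr rfl fun i _ => this i, Finset.sum_add_distrib]
  ring

theorem polyIntegral_zero (r : ℕ) (x : K) :
    polyIntegral p F K 0 r x = ∫ u : F, pnorm p F u ^ r ∂(intHaar p F) := by
  have := properSpace_of_padic p F
  have hS := measurePreserving_eval (fun _ : Fin 1 => intHaar p F) 0
  have hcont : Continuous fun u : F => pnorm p F u ^ r := (continuous_pnorm p F).pow r
  rw [polyIntegral, ← hS.map_eq, integral_map hS.measurable.aemeasurable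
    hcont.aestronglyMeasurable]
  simp [pnorm_algebraMap]

end Extension

/-! ### Coordinates on `K` and the index of 𝒪_F[x] -/

section Extension

variable (p : ℕ) [Fact p.Prime]
  {F : Type*} [NormedField F] [NormedAlgebra ℚ_[p] F] [FiniteDimensional ℚ_[p] F]
  {K : Type*} [NormedField K] [NormedAlgebra ℚ_[p] K] [FiniteDimensional ℚ_[p] K]
  [Algebra F K] [IsScalarTower ℚ_[p] F K]

theorem IsOrthogonalBasis.exists_quadratic {θ : K} {κ : ℝ} (hθ : IsOrthogonalBasis p F θ κ)
    (hK : finrank F K = 2) (u v : integerRing p F) : ∃ t n : integerRing p F,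
      (algebraMap F K u + algebraMap F K v * θ) ^ 2 =
        algebraMap F K t * (algebraMap F K u + algebraMap F K v * θ) - algebraMap F K n := by
  obtain ⟨m, t, hmt⟩ := hθ.exists_eq p hK (θ ^ 2)
  have h1 : ‖θ‖ ≤ 1 := (PadicRoots.mem_integers p F K).mp (hθ.mem_integers p)
  have h2 : ‖θ ^ 2‖ ≤ 1 := by rw [norm_pow]; exact pow_le_one₀ (norm_nonneg _) h1
  rw [← hmt, hθ.norm_le_one_iff] at h2
  let m' : integerRing p F := ⟨m, h2.1⟩
  let t' : integerRing p F := ⟨t, h2.2⟩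
  -- The trace and the norm of u + vθ, given θ² = m + tθ.
  refine ⟨2 * u + v * t', u ^ 2 + u * v * t' - v ^ 2 * m', ?_⟩
  have e1 : ((2 * u + v * t' : integerRing p F) : F) = 2 * (u : F) + v * t := rfl
  have e2 : ((u ^ 2 + u * v * t' - v ^ 2 * m' : integerRing p F) : F) =
    (u : F) ^ 2 + u * v * t - v ^ 2 * m := rfl
  rw [e1, e2]
  simp only [map_add, map_sub, map_mul, map_pow, map_ofNat]
  linear_combination -(algebraMap F K v) ^ 2 * hmt

omit [FiniteDimensional ℚ_[p] F] [NormedAlgebra ℚ_[p] K] [FiniteDimensional ℚ_[p] K]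
  [IsScalarTower ℚ_[p] F K] in
theorem mem_adjoin_quadratic_iff {x : K} {t n : integerRing p F}
    (hx : x ^ 2 = algebraMap F K t * x - algebraMap F K n) (y : K) :
    y ∈ Algebra.adjoin (integerRing p F) {x} ↔
      ∃ a b : integerRing p F, y = algebraMap F K a + algebraMap F K b * x := by
  constructor
  · intro hy
    induction hy using Algebra.adjoin_induction with
    | mem y hy => exact ⟨0, 1, by rw [Set.mem_singleton_iff.mp hy]; simp⟩
    | algebraMap r => exact ⟨r, 0, by simp; rfl⟩
    | add y z _ _ hy hz =>
      obtain ⟨a, b, rfl⟩ := hy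
      obtain ⟨c, d, rfl⟩ := hz
      refine ⟨a + c, b + d, ?_⟩
      simp only [AddMemClass.coe_add, map_add]
      ring
    | mul y z _ _ hy hz =>
      obtain ⟨a, b, rfl⟩ := hy
      obtain ⟨c, d, rfl⟩ := hz
      refine ⟨a * c - b * d * n, a * d + b * c + b * d * t, ?_⟩
      have e1 : ((a * c - b * d * n : integerRing p F) : F) = (a : F) * c - b * d * n := rfl
      have e2 : ((a * d + b * c + b * d * t : integerRing p F) : F) =
        (a : F) * d + b * c + b * d * t := rfl
      rw [e1, e2]
      simp only [map_add, map_sub, map_mul]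
      linear_combination algebraMap F K b * algebraMap F K d * hx
  · rintro ⟨a, b, rfl⟩
    have h1 : algebraMap F K a ∈ Algebra.adjoin (integerRing p F) {x} :=
      Subalgebra.algebraMap_mem _ a
    have h2 : algebraMap F K b ∈ Algebra.adjoin (integerRing p F) {x} :=
      Subalgebra.algebraMap_mem _ b
    exact add_mem h1 (mul_mem h2 (Algebra.self_mem_adjoin_singleton _ x))

theorem IsOrthogonalBasis.adjoin_eq_top_iff {θ : K} {κ : ℝ} (hθ : IsOrthogonalBasis p F θ κ)
    (hK : finrank F K = 2) (u v : F) :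
    Algebra.adjoin F {algebraMap F K u + algebraMap F K v * θ} = ⊤ ↔ v ≠ 0 := by
  constructor
  · rintro h rfl
    rw [map_zero, zero_mul, add_zero, Algebra.adjoin_singleton_algebraMap] at h
    have := Subalgebra.bot_eq_top_iff_finrank_eq_one.mp h
    lia
  · intro hv
    rw [eq_top_iff]
    rintro y -
    obtain ⟨a, b, rfl⟩ := hθ.exists_eq p hK y
    have hv' : algebraMap F K v ≠ 0 := by simpa using hv
    have h1 : algebraMap F K a + algebraMap F K b * θ = algebraMap F K (a - b * u / v) +
        algebraMap F K (b / v) * (algebraMap F K u + algebraMap F K v * θ) := by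
      simp only [map_sub, map_div₀, map_mul]
      field_simp
      ring
    rw [h1]
    exact add_mem (Subalgebra.algebraMap_mem _ _)
      (mul_mem (Subalgebra.algebraMap_mem _ _) (Algebra.self_mem_adjoin_singleton _ _))

/-- The coordinates of `K` in a basis `1, θ` over `F`. -/
def coordEquiv {θ : K} {κ : ℝ} (hθ : IsOrthogonalBasis p F θ κ) (hK : finrank F K = 2) :
    (F × F) ≃L[ℚ_[p]] K :=
  (LinearEquiv.ofBijective
    { toFun := fun w : F × F => algebraMap F K w.1 + algebraMap F K w.2 * θ
      map_add' := fun w z => by simp only [Prod.fst_add, Prod.snd_add, map_add]; ring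
      map_smul' := fun c w => by
        change algebraMap F K (c • w.1) + algebraMap F K (c • w.2) * θ =
          c • (algebraMap F K w.1 + algebraMap F K w.2 * θ)
        rw [Algebra.smul_def, Algebra.smul_def, Algebra.smul_def, map_mul, map_mul,
          ← IsScalarTower.algebraMap_apply ℚ_[p] F K]
        ring }
    ⟨by
      rw [injective_iff_map_eq_zero]
      intro w hw
      obtain ⟨h1, h2⟩ := hθ.coeff_eq_zero p hw
      exact Prod.ext h1 h2,
     fun x => by
      obtain ⟨u, v, h⟩ := hθ.exists_eq p hK x
      exact ⟨(u, v), h⟩⟩).toContinuousLinearEquiv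

theorem coordEquiv_apply {θ : K} {κ : ℝ} (hθ : IsOrthogonalBasis p F θ κ)
    (hK : finrank F K = 2) (w : F × F) :
    coordEquiv p hθ hK w = algebraMap F K w.1 + algebraMap F K w.2 * θ := rfl

theorem coordEquiv_preimage_integerRing {θ : K} {κ : ℝ} (hθ : IsOrthogonalBasis p F θ κ)
    (hK : finrank F K = 2) : coordEquiv p hθ hK ⁻¹' (integerRing p K : Set K) =
      (integerRing p F : Set F) ×ˢ (integerRing p F : Set F) := by
  ext w
  exact hθ.norm_le_one_iff w.1 w.2

variable [MeasurableSpace F] [BorelSpace F] [MeasurableSpace K] [BorelSpace K]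

/-- By uniqueness of Haar measure: orthogonality makes 𝒪_F × 𝒪_F the preimage of 𝒪_K, so the
normalizations agree. -/
theorem map_coordEquiv_haar {θ : K} {κ : ℝ} (hθ : IsOrthogonalBasis p F θ κ)
    (hK : finrank F K = 2) :
    ((haar p F).prod (haar p F)).map (coordEquiv p hθ hK) = haar p K := by
  have := properSpace_of_padic p F
  have := properSpace_of_padic p K
  have := (coordEquiv p hθ hK).isAddHaarMeasure_map ((haar p F).prod (haar p F))
  refine eq_haar p K _ ?_
  rw [Measure.map_apply (coordEquiv p hθ hK).continuous.measurable
    (measurableSet_integerRing p K), coordEquiv_preimage_integerRing, Measure.prod_prod,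
    haar_integerRing, one_mul]

theorem measurableEmbedding_coordEquiv {θ : K} {κ : ℝ} (hθ : IsOrthogonalBasis p F θ κ)
    (hK : finrank F K = 2) : MeasurableEmbedding (coordEquiv p hθ hK) := by
  have := properSpace_of_padic p F
  exact (coordEquiv p hθ hK).toHomeomorph.measurableEmbedding

theorem setIntegral_eq_coord {θ : K} {κ : ℝ} (hθ : IsOrthogonalBasis p F θ κ)
    (hK : finrank F K = 2) (g : K → ℝ) (s : Set K) :
    ∫ x in s, g x ∂(haar p K) = ∫ w in coordEquiv p hθ hK ⁻¹' s,
      g (algebraMap F K w.1 + algebraMap F K w.2 * θ) ∂((haar p F).prod (haar p F)) := by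
  rw [← map_coordEquiv_haar p hθ hK, (measurableEmbedding_coordEquiv p hθ hK).setIntegral_map]
  rfl

theorem integrableOn_iff_coord {θ : K} {κ : ℝ} (hθ : IsOrthogonalBasis p F θ κ)
    (hK : finrank F K = 2) (g : K → ℝ) (s : Set K) :
    IntegrableOn g s (haar p K) ↔ IntegrableOn
      (fun w : F × F => g (algebraMap F K w.1 + algebraMap F K w.2 * θ))
      (coordEquiv p hθ hK ⁻¹' s) ((haar p F).prod (haar p F)) := by
  rw [← map_coordEquiv_haar p hθ hK,
    (measurableEmbedding_coordEquiv p hθ hK).integrableOn_map_iff]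
  rfl

/-- The index is read off from measures: in coordinates 𝒪_F[x] is 𝒪_F × v𝒪_F, of mass ‖v‖, inside
𝒪_K of mass 1. -/
theorem index_mul_pnorm {θ : K} {κ : ℝ} (hθ : IsOrthogonalBasis p F θ κ)
    (hK : finrank F K = 2) (u v : integerRing p F) (hv : (v : F) ≠ 0) :
    (index p F K (algebraMap F K u + algebraMap F K v * θ) : ℝ) * pnorm p F (v : F) = 1 := by
  have := properSpace_of_padic p F
  obtain ⟨t, n, htn⟩ := hθ.exists_quadratic p hK u v
  set x := algebraMap F K u + algebraMap F K v * θ with hx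
  set H := (Subalgebra.toSubmodule (Algebra.adjoin (integerRing p F) {x})).toAddSubgroup with hH
  set M := (Subalgebra.toSubmodule (integers p F K)).toAddSubgroup with hM
  have hHmem (y : K) : y ∈ H ↔
      ∃ a b : integerRing p F, y = algebraMap F K a + algebraMap F K b * x :=
    mem_adjoin_quadratic_iff p htn y
  have hpre : coordEquiv p hθ hK ⁻¹' (H : Set K) =
      (integerRing p F : Set F) ×ˢ ((v : F) • (integerRing p F : Set F)) := by
    ext w
    rw [mem_preimage, SetLike.mem_coe, hHmem, coordEquiv_apply, mem_prod]
    constructor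
    · rintro ⟨a, b, hab⟩
      have h0 : algebraMap F K (w.1 - (a + b * u)) + algebraMap F K (w.2 - b * v) * θ = 0 := by
        simp only [map_sub, map_add, map_mul]
        rw [hx] at hab
        linear_combination hab
      obtain ⟨h1, h2⟩ := hθ.coeff_eq_zero p h0
      rw [sub_eq_zero] at h1 h2
      refine ⟨?_, ?_⟩
      · rw [h1]; exact (a + b * u).2
      · rw [h2]; exact ⟨b, b.2, mul_comm _ _⟩
    · rintro ⟨h1, b, hb, h2⟩
      let b' : integerRing p F := ⟨b, hb⟩
      refine ⟨⟨w.1, h1⟩ - b' * u, b', ?_⟩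
      have e1 : ((⟨w.1, h1⟩ - b' * u : integerRing p F) : F) = w.1 - b * u := rfl
      have e2 : w.2 = b * v := by rw [← h2]; exact mul_comm _ _
      rw [e1, e2, hx]
      simp only [map_sub, map_mul, b']
      ring
  have hHm : MeasurableSet (H : Set K) := by
    have h1 : MeasurableSet ((integerRing p F : Set F) ×ˢ
        ((v : F) • (integerRing p F : Set F))) :=
      (measurableSet_integerRing p F).prod
        ((measurableSet_integerRing p F).const_smul_of_ne_zero hv)
    rw [← hpre] at h1
    have h2 := (measurableEmbedding_coordEquiv p hθ hK).measurableSet_image.mpr h1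
    rwa [Set.image_preimage_eq _ (coordEquiv p hθ hK).surjective] at h2
  have hHμ : haar p K (H : Set K) = ENNReal.ofReal (pnorm p F (v : F)) := by
    rw [← map_coordEquiv_haar p hθ hK, (measurableEmbedding_coordEquiv p hθ hK).map_apply, hpre,
      Measure.prod_prod, haar_smul p F hv, haar_integerRing, one_mul, mul_one, pnorm]
  have hMμ : haar p K (M : Set K) = 1 := by
    have : (M : Set K) = (integerRing p K : Set K) := by
      ext y; exact PadicRoots.mem_integers p F K
    rw [this, haar_integerRing]
  have hpos : 0 < pnorm p F (v : F) := (pnorm_pos_iff p F).mpr hv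
  have hle : H ≤ M := by
    have : Algebra.adjoin (integerRing p F) {x} ≤ integers p F K := by
      rw [Algebra.adjoin_le_iff, Set.singleton_subset_iff, SetLike.mem_coe,
        PadicRoots.mem_integers, hx, hθ.norm_le_one_iff]
      exact ⟨u.2, v.2⟩
    exact this
  have h := relIndex_mul_measure (haar p K) hle hHm (by
    rw [hHμ]; exact (ENNReal.ofReal_pos.mpr hpos).ne') (by rw [hMμ]; exact ENNReal.one_ne_top)
  rw [hHμ, hMμ] at h
  have h2 := congrArg ENNReal.toReal h
  rw [ENNReal.toReal_mul, ENNReal.toReal_ofReal hpos.le] at h2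
  have h3 : index p F K x = H.relIndex M := rfl
  rw [h3]
  simpa using h2

end Extension

/-! ### Reduction of ρ_n(K) to integrals over 𝒪_F -/

section Extension

variable (p : ℕ) [Fact p.Prime]
  {F : Type*} [NormedField F] [NormedAlgebra ℚ_[p] F] [FiniteDimensional ℚ_[p] F]
  {K : Type*} [NormedField K] [NormedAlgebra ℚ_[p] K] [FiniteDimensional ℚ_[p] K]
  [Algebra F K] [IsScalarTower ℚ_[p] F K]
  [MeasurableSpace F] [BorelSpace F] [MeasurableSpace K] [BorelSpace K]

omit [MeasurableSpace F] [BorelSpace F] [MeasurableSpace K] [BorelSpace K] in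
theorem pnorm_pow_two_mul_finrank (x : K) :
    pnorm p F x ^ (2 * finrank F K) = ‖x‖ ^ (2 * finrank ℚ_[p] K) := by
  have := FiniteDimensional.right ℚ_[p] F K
  rw [pnorm, ← pow_mul, ← finrank_mul_finrank ℚ_[p] F K]
  congr 1
  ring

theorem integrable_density_and_rho_eq {n : ℕ}
    (hg : IntegrableOn (densityOnIntegers p F K n) (integerRing p K) (haar p K)) :
    Integrable (density p F K n) (haar p K) ∧
      rho p F K n = ∫ x in (integerRing p K : Set K), densityOnIntegers p F K n x ∂(haar p K) +
        ∫ x in (openUnitBall p K : Set K), densityOnIntegers p F K n x ∂(haar p K) := by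
  have hO := measurableSet_integerRing p K
  have hcompl : (integerRing p K : Set K)ᶜ = {x : K | 1 < ‖x‖} := by
    ext x
    exact not_le (a := ‖x‖) (b := 1)
  have hgt : MeasurableSet {x : K | 1 < ‖x‖} := measurableSet_lt measurable_const measurable_norm
  have h1 : EqOn (density p F K n) (densityOnIntegers p F K n) (integerRing p K : Set K) := by
    intro x hx
    rw [density, if_pos ((mem_integers p F K).mpr hx)]
  have h2 : EqOn (density p F K n) (fun x => (‖x‖ ^ (2 * finrank ℚ_[p] K))⁻¹ *
      densityOnIntegers p F K n x⁻¹) {x : K | 1 < ‖x‖} := by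
    intro x hx
    rw [density, if_neg (fun h => absurd ((mem_integers p F K).mp h) (not_le.mpr hx)),
      pnorm_pow_two_mul_finrank]
  have hsub : (openUnitBall p K : Set K) ⊆ (integerRing p K : Set K) :=
    fun x hx => (le_of_lt hx : ‖x‖ ≤ 1)
  have hi1 : IntegrableOn (density p F K n) (integerRing p K) (haar p K) :=
    hg.congr_fun h1.symm hO
  have hi2 : IntegrableOn (density p F K n) (integerRing p K : Set K)ᶜ (haar p K) := by
    rw [hcompl]
    exact (integrableOn_inv p K _ (hg.mono_set hsub)).congr_fun h2.symm hgt
  have hi : Integrable (density p F K n) (haar p K) := by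
    rw [← integrableOn_univ, ← Set.union_compl_self (integerRing p K : Set K)]
    exact hi1.union hi2
  refine ⟨hi, ?_⟩
  rw [rho, ← integral_add_compl hO hi, hcompl, setIntegral_congr_fun hO h1,
    setIntegral_congr_fun hgt h2, integral_inv]
  rfl

section Coordinates

variable {θ : K} {κ : ℝ} (hθ : IsOrthogonalBasis p F θ κ) (hK : finrank F K = 2)
  {g : K → ℝ} {G : F → ℝ}
  (hgG : ∀ u v : F, ‖u‖ ≤ 1 → ‖v‖ ≤ 1 → g (algebraMap F K u + algebraMap F K v * θ) = G v)

include hθ hK hgG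

theorem integrableOn_of_coord (hG : Integrable G (intHaar p F)) :
    IntegrableOn g (integerRing p K) (haar p K) := by
  have := properSpace_of_padic p F
  have hO := measurableSet_integerRing p F
  rw [integrableOn_iff_coord p hθ hK, coordEquiv_preimage_integerRing]
  refine IntegrableOn.congr_fun (f := fun w : F × F => G w.2) ?_ ?_ (hO.prod hO)
  · rw [IntegrableOn, ← Measure.prod_restrict]
    exact hG.comp_snd _
  · intro w hw
    exact (hgG w.1 w.2 hw.1 hw.2).symm

theorem setIntegral_of_coord {s : Set K} {a b : Set F} (ha : MeasurableSet a)
    (hb : MeasurableSet b) (haO : a ⊆ (integerRing p F : Set F))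
    (hbO : b ⊆ (integerRing p F : Set F)) (hs : coordEquiv p hθ hK ⁻¹' s = a ×ˢ b) :
    ∫ x in s, g x ∂(haar p K) = (haar p F).real a * ∫ v in b, G v ∂(haar p F) := by
  have := properSpace_of_padic p F
  rw [setIntegral_eq_coord p hθ hK, hs,
    setIntegral_congr_fun (g := fun w : F × F => G w.2) (ha.prod hb)
      (fun w hw => hgG w.1 w.2 (haO hw.1) (hbO hw.2)),
    ← Measure.prod_restrict, integral_fun_snd, smul_eq_mul, measureReal_def,
    Measure.restrict_apply_univ, measureReal_def]

theorem setIntegral_integerRing_of_coord :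
    ∫ x in (integerRing p K : Set K), g x ∂(haar p K) = ∫ v, G v ∂(intHaar p F) := by
  have hO := measurableSet_integerRing p F
  rw [setIntegral_of_coord p hθ hK hgG hO hO subset_rfl subset_rfl
    (coordEquiv_preimage_integerRing p hθ hK), measureReal_def, haar_integerRing]
  simp

end Coordinates

theorem haar_real_openUnitBall :
    (haar p F).real (openUnitBall p F : Set F) = (residueCard p F : ℝ)⁻¹ := by
  have h := congrArg ENNReal.toReal (residueCard_mul_haar p F)
  rw [ENNReal.toReal_mul] at h
  exact eq_inv_of_mul_eq_one_right (by simpa [measureReal_def] using h)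

omit [FiniteDimensional ℚ_[p] F] [MeasurableSpace F] [BorelSpace F] in
theorem openUnitBall_subset : (openUnitBall p F : Set F) ⊆ (integerRing p F : Set F) :=
  fun x hx => (le_of_lt hx : ‖x‖ ≤ 1)

/-- Here the maximal ideal is ϖ𝒪_F ⊕ ϖ𝒪_F θ: each coordinate contributes a factor 1/q, and v is
rescaled by ϖ. -/
theorem setIntegral_openUnitBall_of_residue {θ : K}
    (hθ : ∀ a : F, ‖a‖ ≤ 1 → ‖θ - algebraMap F K a‖ = 1) (hK : finrank F K = 2) {ϖ : F}
    (h0 : ϖ ≠ 0) (h : ∀ x : F, ‖x‖ < 1 ↔ ‖x‖ ≤ ‖ϖ‖) {g : K → ℝ} {G : F → ℝ}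
    (hgG : ∀ u v : F, ‖u‖ ≤ 1 → ‖v‖ ≤ 1 → g (algebraMap F K u + algebraMap F K v * θ) = G v) :
    ∫ x in (openUnitBall p K : Set K), g x ∂(haar p K) =
      ((residueCard p F : ℝ)⁻¹) ^ 2 * ∫ v, G (ϖ * v) ∂(intHaar p F) := by
  have hm := measurableSet_openUnitBall p F
  rw [setIntegral_of_coord p (isOrthogonalBasis_of_residue p F hθ) hK hgG hm hm
    (openUnitBall_subset p) (openUnitBall_subset p), haar_real_openUnitBall,
    setIntegral_openUnitBall_eq p F h0 h, pow_two, mul_assoc]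
  ext w
  rw [mem_preimage, coordEquiv_apply, SetLike.mem_coe, mem_openUnitBall,
    norm_add_mul_eq_max_of_residue p F hθ, max_lt_iff]
  rfl

/-- Here θ itself is in the maximal ideal, which is ϖ𝒪_F ⊕ 𝒪_F θ; v still runs over all of 𝒪_F. -/
theorem setIntegral_openUnitBall_of_sq {θ : K} {ϖ : F} (h0 : ϖ ≠ 0) (h1 : ‖ϖ‖ < 1)
    (h : ∀ x : F, ‖x‖ < 1 ↔ ‖x‖ ≤ ‖ϖ‖) (hθ : ‖θ‖ ^ 2 = ‖ϖ‖) (hK : finrank F K = 2)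
    {g : K → ℝ} {G : F → ℝ}
    (hgG : ∀ u v : F, ‖u‖ ≤ 1 → ‖v‖ ≤ 1 → g (algebraMap F K u + algebraMap F K v * θ) = G v) :
    ∫ x in (openUnitBall p K : Set K), g x ∂(haar p K) =
      (residueCard p F : ℝ)⁻¹ * ∫ v, G v ∂(intHaar p F) := by
  have hb := isOrthogonalBasis_of_sq p F h0 h1 h hθ
  rw [setIntegral_of_coord p hb hK hgG (measurableSet_openUnitBall p F)
    (measurableSet_integerRing p F) (openUnitBall_subset p) subset_rfl, haar_real_openUnitBall]
  have hθ1 : ‖θ‖ < 1 := by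
    by_contra hge
    have := one_le_pow₀ (n := 2) (not_lt.mp hge)
    linarith
  ext w
  have h2 := hb.norm_le_one_iff 0 w.2
  rw [norm_add_mul_eq_max_of_sq p F h0 h1 h hθ] at h2
  simp only [norm_zero, zero_le_one, true_and, max_le_iff] at h2
  rw [mem_preimage, coordEquiv_apply, SetLike.mem_coe, mem_openUnitBall,
    norm_add_mul_eq_max_of_sq p F h0 h1 h hθ, max_lt_iff]
  refine and_congr_right fun _ => ⟨fun hlt => h2.mp hlt.le, fun hle => ?_⟩
  have hle' : ‖w.2‖ ≤ 1 := hle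
  nlinarith [norm_nonneg w.2, norm_nonneg θ]

omit [MeasurableSpace K] [BorelSpace K] in
theorem densityOnIntegers_of_lt (hK : finrank F K = 2) {n : ℕ} (hn : n < 2) (x : K) :
    densityOnIntegers p F K n x = 0 := by
  rw [densityOnIntegers, if_neg]
  rw [hK]
  lia

theorem densityOnIntegers_eq {θ : K} {κ : ℝ} (hθ : IsOrthogonalBasis p F θ κ)
    (hK : finrank F K = 2) {n : ℕ} (hn : 2 ≤ n) {u v : F} (hu : ‖u‖ ≤ 1) (hv : ‖v‖ ≤ 1) :
    densityOnIntegers p F K n (algebraMap F K u + algebraMap F K v * θ) =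
      pnorm p F (discriminant p F K : F) * (pnorm p F v *
        polyIntegral p F K (n - 2) 2 (algebraMap F K u + algebraMap F K v * θ)) := by
  rw [densityOnIntegers, hθ.adjoin_eq_top_iff p hK, hK]
  by_cases hv0 : v = 0
  -- For v = 0 the element does not generate `K` and the density is 0 by definition, in agreement
  -- with the factor ‖v‖.
  · rw [if_neg (by simp [hv0]), hv0, (pnorm_eq_zero_iff p F).mpr rfl, zero_mul, mul_zero]
  · rw [if_pos ⟨hn, hv0⟩]
    have h := index_mul_pnorm p hθ hK ⟨u, hu⟩ ⟨v, hv⟩ hv0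
    rw [div_eq_mul_inv, mul_assoc]
    congr 2
    exact (eq_inv_of_mul_eq_one_right h).symm

omit [MeasurableSpace K] [BorelSpace K] in
theorem polyIntegral_eq_maxIntegral {θ : K} {κ : ℝ} (hθ : IsOrthogonalBasis p F θ κ)
    (hK : finrank F K = 2) (m : ℕ) {u v : F} (hu : ‖u‖ ≤ 1) (hv : ‖v‖ ≤ 1) :
    polyIntegral p F K (m + 1) 2 (algebraMap F K u + algebraMap F K v * θ) =
      maxIntegral p F κ (pnorm p F v) := by
  have := properSpace_of_padic p F
  obtain ⟨t, n, htn⟩ := hθ.exists_quadratic p hK ⟨u, hu⟩ ⟨v, hv⟩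
  have hS := measurePreserving_shear p F hu
  rw [polyIntegral_quadratic p htn, maxIntegral]
  -- Since a + b(u + vθ) = (a + bu) + bvθ, the shear by u removes the dependence on u.
  nth_rw 2 [← hS.map_eq]
  rw [integral_map hS.measurable.aemeasurable
    (continuous_max_pnorm p F κ _).aestronglyMeasurable]
  refine integral_congr_ae (Filter.Eventually.of_forall fun w => ?_)
  have h1 : algebraMap F K w.1 + algebraMap F K w.2 * (algebraMap F K u + algebraMap F K v * θ) =
      algebraMap F K (w.1 + w.2 * u) + algebraMap F K (w.2 * v) * θ := by
    simp only [map_add, map_mul]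
    ring
  simp only
  rw [h1, hθ.pnorm_sq, pnorm_mul]
  congr 1
  ring

theorem densityOnIntegers_two {θ : K} {κ : ℝ} (hθ : IsOrthogonalBasis p F θ κ)
    (hK : finrank F K = 2) (u v : F) (hu : ‖u‖ ≤ 1) (hv : ‖v‖ ≤ 1) :
    densityOnIntegers p F K 2 (algebraMap F K u + algebraMap F K v * θ) =
      pnorm p F (discriminant p F K : F) * (pnorm p F v *
        ∫ c : F, pnorm p F c ^ 2 ∂(intHaar p F)) := by
  rw [densityOnIntegers_eq p hθ hK le_rfl hu hv, polyIntegral_zero]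

theorem densityOnIntegers_of_three_le {θ : K} {κ : ℝ} (hθ : IsOrthogonalBasis p F θ κ)
    (hK : finrank F K = 2) {n : ℕ} (hn : 3 ≤ n) (u v : F) (hu : ‖u‖ ≤ 1) (hv : ‖v‖ ≤ 1) :
    densityOnIntegers p F K n (algebraMap F K u + algebraMap F K v * θ) =
      pnorm p F (discriminant p F K : F) * (pnorm p F v * maxIntegral p F κ (pnorm p F v)) := by
  obtain ⟨m, rfl⟩ := Nat.exists_eq_add_of_le' hn
  rw [densityOnIntegers_eq p hθ hK (by lia) hu hv, ← polyIntegral_eq_maxIntegral p hθ hK m hu hv]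
  rfl

theorem integrableOn_densityOnIntegers {θ : K} {κ : ℝ} (hθ : IsOrthogonalBasis p F θ κ)
    (hK : finrank F K = 2) (n : ℕ) :
    IntegrableOn (densityOnIntegers p F K n) (integerRing p K) (haar p K) := by
  rcases lt_trichotomy n 2 with hn | rfl | hn
  · rw [funext (densityOnIntegers_of_lt p hK hn)]
    exact integrableOn_zero
  · exact integrableOn_of_coord p hθ hK (densityOnIntegers_two p hθ hK)
      (((integrable_intHaar p F (continuous_pnorm p F)).mul_const _).const_mul _)
  · exact integrableOn_of_coord p hθ hK (densityOnIntegers_of_three_le p hθ hK hn)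
      ((integrable_pnorm_mul_maxIntegral p F κ).const_mul _)

end Extension

/-! ### Evaluation in the two cases -/

section Extension

variable (p : ℕ) [Fact p.Prime]
  {F : Type*} [NormedField F] [NormedAlgebra ℚ_[p] F] [FiniteDimensional ℚ_[p] F]
  {K : Type*} [NormedField K] [NormedAlgebra ℚ_[p] K] [FiniteDimensional ℚ_[p] K]
  [Algebra F K] [IsScalarTower ℚ_[p] F K]
  [MeasurableSpace F] [BorelSpace F] [MeasurableSpace K] [BorelSpace K]

theorem rho_two_of_residue {θ : K} (hθ : ∀ a : F, ‖a‖ ≤ 1 → ‖θ - algebraMap F K a‖ = 1)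
    (hK : finrank F K = 2) {q : ℝ} (hq : q = residueCard p F) :
    rho p F K 2 = (q ^ 2 - q + 1) / (q ^ 2 + q + 1) := by
  obtain ⟨ϖ, h0, h1, h⟩ := exists_uniformizer p F
  have hb := isOrthogonalBasis_of_residue p F hθ
  have hform := densityOnIntegers_two p hb hK
  rw [(integrable_density_and_rho_eq p (integrableOn_densityOnIntegers p hb hK 2)).2,
    setIntegral_integerRing_of_coord p hb hK hform,
    setIntegral_openUnitBall_of_residue p hθ hK h0 h hform]
  have hM1 := integral_pnorm_pow p F 1
  simp only [pow_one] at hM1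
  simp only [pnorm_mul, pnorm_uniformizer p F h0 h, integral_const_mul, integral_mul_const, hM1,
    integral_pnorm_pow p F 2, pnorm_discriminant_eq_one p hK hθ]
  have hq1 := one_lt_residueCard p F
  rw [← hq] at hq1 ⊢
  have e1 : q ^ 2 - 1 ≠ 0 := by nlinarith
  have e2 : q ^ 3 - 1 ≠ 0 := (sub_pos.mpr (one_lt_pow₀ hq1 (by lia))).ne'
  have e5 : q ≠ 0 := by positivity
  have e6 : q ^ 2 + q + 1 ≠ 0 := by positivity
  have e7 : 1 - q⁻¹ ^ (1 + 1) = (q ^ 2 - 1) / q ^ 2 := by rw [one_add_one_eq_two]; field_simp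
  have e8 : 1 - q⁻¹ ^ (2 + 1) = (q ^ 3 - 1) / q ^ 3 := by rw [two_add_one_eq_three]; field_simp
  rw [e7, e8]
  field_simp
  ring

theorem rho_of_residue {θ : K} (hθ : ∀ a : F, ‖a‖ ≤ 1 → ‖θ - algebraMap F K a‖ = 1)
    (hK : finrank F K = 2) {q : ℝ} (hq : q = residueCard p F) {n : ℕ} (hn : 3 ≤ n) :
    rho p F K n = (q ^ 4 + 1) / (q ^ 4 + q ^ 3 + q ^ 2 + q + 1) := by
  obtain ⟨ϖ, h0, h1, h⟩ := exists_uniformizer p F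
  have hb := isOrthogonalBasis_of_residue p F hθ
  have hform := densityOnIntegers_of_three_le p hb hK hn
  rw [(integrable_density_and_rho_eq p (integrableOn_densityOnIntegers p hb hK n)).2,
    setIntegral_integerRing_of_coord p hb hK hform,
    setIntegral_openUnitBall_of_residue p hθ hK h0 h hform, integral_const_mul,
    integral_const_mul, pnorm_discriminant_eq_one p hK hθ,
    integral_pnorm_uniformizer_mul_maxIntegral p F zero_le_one le_rfl h0 h rfl,
    integral_pnorm_mul_maxIntegral p F zero_le_one le_rfl rfl, maxIntegral_one_one]
  have hq1 := one_lt_residueCard p F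
  rw [← hq] at hq1 ⊢
  have e1 : q ^ 5 - 1 ≠ 0 := (sub_pos.mpr (one_lt_pow₀ hq1 (by lia))).ne'
  have e5 : q ≠ 0 := by positivity
  have e6 : q + 1 ≠ 0 := by positivity
  have e9 : q ^ 4 + q ^ 3 + q ^ 2 + q + 1 ≠ 0 := by positivity
  have e7 : 1 - q⁻¹ ^ 5 = (q ^ 5 - 1) / q ^ 5 := by field_simp
  have e8 : 1 + q⁻¹ = (q + 1) / q := by field_simp
  rw [e7, e8]
  field_simp
  ring

theorem rho_two_of_sq {θ : K} {ϖ : F} (h0 : ϖ ≠ 0) (h1 : ‖ϖ‖ < 1)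
    (h : ∀ x : F, ‖x‖ < 1 ↔ ‖x‖ ≤ ‖ϖ‖) (hθ : ‖θ‖ ^ 2 = ‖ϖ‖) (hK : finrank F K = 2)
    {q : ℝ} (hq : q = residueCard p F) :
    rho p F K 2 = pnorm p F (discriminant p F K : F) * (q ^ 2 / (q ^ 2 + q + 1)) := by
  have hb := isOrthogonalBasis_of_sq p F h0 h1 h hθ
  have hform := densityOnIntegers_two p hb hK
  rw [(integrable_density_and_rho_eq p (integrableOn_densityOnIntegers p hb hK 2)).2,
    setIntegral_integerRing_of_coord p hb hK hform,
    setIntegral_openUnitBall_of_sq p h0 h1 h hθ hK hform]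
  have hM1 := integral_pnorm_pow p F 1
  simp only [pow_one] at hM1
  simp only [integral_const_mul, integral_mul_const, hM1, integral_pnorm_pow p F 2]
  have hq1 := one_lt_residueCard p F
  rw [← hq] at hq1 ⊢
  have e1 : q ^ 2 - 1 ≠ 0 := by nlinarith
  have e2 : q ^ 3 - 1 ≠ 0 := (sub_pos.mpr (one_lt_pow₀ hq1 (by lia))).ne'
  have e5 : q ≠ 0 := by positivity
  have e6 : q ^ 2 + q + 1 ≠ 0 := by positivity
  have e7 : 1 - q⁻¹ ^ (1 + 1) = (q ^ 2 - 1) / q ^ 2 := by rw [one_add_one_eq_two]; field_simp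
  have e8 : 1 - q⁻¹ ^ (2 + 1) = (q ^ 3 - 1) / q ^ 3 := by rw [two_add_one_eq_three]; field_simp
  rw [e7, e8]
  field_simp
  ring

theorem rho_of_sq {θ : K} {ϖ : F} (h0 : ϖ ≠ 0) (h1 : ‖ϖ‖ < 1)
    (h : ∀ x : F, ‖x‖ < 1 ↔ ‖x‖ ≤ ‖ϖ‖) (hθ : ‖θ‖ ^ 2 = ‖ϖ‖) (hK : finrank F K = 2)
    {q : ℝ} (hq : q = residueCard p F) {n : ℕ} (hn : 3 ≤ n) :
    rho p F K n = pnorm p F (discriminant p F K : F) *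
      (q ^ 2 * (q ^ 2 + 1) / (q ^ 4 + q ^ 3 + q ^ 2 + q + 1)) := by
  have hb := isOrthogonalBasis_of_sq p F h0 h1 h hθ
  have hform := densityOnIntegers_of_three_le p hb hK hn
  rw [(integrable_density_and_rho_eq p (integrableOn_densityOnIntegers p hb hK n)).2,
    setIntegral_integerRing_of_coord p hb hK hform,
    setIntegral_openUnitBall_of_sq p h0 h1 h hθ hK hform, integral_const_mul,
    integral_pnorm_mul_maxIntegral p F hb.pos.le hb.le_one rfl, pnorm_uniformizer p F h0 h,
    maxIntegral_inv_one]
  have hq1 := one_lt_residueCard p F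
  rw [← hq] at hq1 ⊢
  have e1 : q ^ 5 - 1 ≠ 0 := (sub_pos.mpr (one_lt_pow₀ hq1 (by lia))).ne'
  have e5 : q ≠ 0 := by positivity
  have e6 : q + 1 ≠ 0 := by positivity
  have e9 : q ^ 4 + q ^ 3 + q ^ 2 + q + 1 ≠ 0 := by positivity
  have e7 : 1 - q⁻¹ ^ 5 = (q ^ 5 - 1) / q ^ 5 := by field_simp
  have e8 : 1 + q⁻¹ = (q + 1) / q := by field_simp
  rw [e7, e8]
  field_simp
  ring

omit [MeasurableSpace F] [BorelSpace F] [MeasurableSpace K] [BorelSpace K] in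
include p in
theorem exists_norm_eq_of_residue {θ : K} (hK : finrank F K = 2)
    (hθ : ∀ a : F, ‖a‖ ≤ 1 → ‖θ - algebraMap F K a‖ = 1) (x : K) : ∃ a : F, ‖x‖ = ‖a‖ := by
  obtain ⟨u, v, rfl⟩ := (isOrthogonalBasis_of_residue p F hθ).exists_eq p hK x
  rw [norm_add_mul_eq_max_of_residue p F hθ]
  rcases le_total ‖u‖ ‖v‖ with h | h
  · exact ⟨v, max_eq_right h⟩
  · exact ⟨u, max_eq_left h⟩

end Extension

end PadicRoots

end

theorem theoremC (p : ℕ) [Fact p.Prime]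
    (F : Type*) [NormedField F] [NormedAlgebra ℚ_[p] F] [FiniteDimensional ℚ_[p] F]
    [MeasurableSpace F] [BorelSpace F]
    (K : Type*) [NormedField K] [NormedAlgebra ℚ_[p] K] [FiniteDimensional ℚ_[p] K]
    [MeasurableSpace K] [BorelSpace K]
    [Algebra F K] [IsScalarTower ℚ_[p] F K]
    (hK : Module.finrank F K = 2)
    (q : ℝ) (hq : q = PadicRoots.residueCard p F) :
    (∀ n : ℕ, 1 ≤ n → Integrable (PadicRoots.density p F K n) (PadicRoots.haar p K)) ∧
    (PadicRoots.IsUnramified p F K →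
      PadicRoots.rho p F K 2 = (q ^ 2 - q + 1) / (q ^ 2 + q + 1) ∧
      ∀ n : ℕ, 3 ≤ n →
        PadicRoots.rho p F K n = (q ^ 4 + 1) / (q ^ 4 + q ^ 3 + q ^ 2 + q + 1)) ∧
    (PadicRoots.IsTotallyRamified p F K →
      PadicRoots.rho p F K 2 =
        PadicRoots.pnorm p F (PadicRoots.discriminant p F K : F) *
          (q ^ 2 / (q ^ 2 + q + 1)) ∧
      ∀ n : ℕ, 3 ≤ n →
        PadicRoots.rho p F K n =
          PadicRoots.pnorm p F (PadicRoots.discriminant p F K : F) *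
            (q ^ 2 * (q ^ 2 + 1) / (q ^ 4 + q ^ 3 + q ^ 2 + q + 1))) := by
  obtain ⟨ϖ, h0, h1, h⟩ := PadicRoots.exists_uniformizer p F
  -- The split is on the residue extension, not on ramification: in each branch integrability and
  -- one formula are proved, and the hypothesis of the other formula is refuted.
  rcases PadicRoots.residue_dichotomy p F (K := K) with ⟨θ, hθ⟩ | hres
  · have hb := PadicRoots.isOrthogonalBasis_of_residue p F hθ
    refine ⟨fun n _ => (PadicRoots.integrable_density_and_rho_eq p
      (PadicRoots.integrableOn_densityOnIntegers p hb hK n)).1, fun _ =>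
      ⟨PadicRoots.rho_two_of_residue p hθ hK hq,
        fun n hn => PadicRoots.rho_of_residue p hθ hK hq hn⟩, fun hram => absurd hram ?_⟩
    exact PadicRoots.not_isTotallyRamified_of_norm_mem_range p F hK
      (PadicRoots.exists_norm_eq_of_residue p hK hθ)
  · obtain ⟨θ, hθ⟩ := PadicRoots.exists_norm_sq_eq p F hK h0 h hres
    have hb := PadicRoots.isOrthogonalBasis_of_sq p F h0 h1 h hθ
    exact ⟨fun n _ => (PadicRoots.integrable_density_and_rho_eq p
      (PadicRoots.integrableOn_densityOnIntegers p hb hK n)).1,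
      fun hunr => absurd hunr (PadicRoots.not_isUnramified_of_sq p F h0 h1 h hθ),
      fun _ => ⟨PadicRoots.rho_two_of_sq p h0 h1 h hθ hK hq,
        fun n hn => PadicRoots.rho_of_sq p h0 h1 h hθ hK hq hn⟩⟩
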